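/- Let $E=\{\zeta_1,\dots,\zeta_N\}$ be a finite set of distinct points of the unit circle, let $q_1,\dots,q_N\ge 0$ and $\varepsilon>0$, and write $x_+=\max\{x,0\}$. For a function $f$ analytic in the open unit disk $\mathbb D$ and not identically zero, let $Z_f$ denote the zeros of $f$ in $\mathbb D$, counted with multiplicity. (i) There is a constant $C=C(\varepsilon,\{q_j\},E)>0$ such that for every function $f_1$ analytic in $\mathbb D$ with $|f_1(0)|=1$ and every real $K_1$ with $$|f_1(z)|\le \exp\Bigl(K_1\prod_{j=1}^N|z-\zeta_j|^{-q_j}\Bigr),\qquad z\in\mathbb D,$$ one has $$\sum_{z\in Z_{f_1}}(1-|z|)\prod_{j=1}^N|z-\zeta_j|^{(q_j-1+\varepsilon)_+}\le C\,K_1 .$$ (ii) For every $p\ge 0$ there is a constant $C=C(\varepsilon,p,\{q_j\},E)>0$ such that for every function $f_2$ analytic in $\mathbb D$ with $|f_2(0)|=1$ and every real $K_2$ with $$|f_2(z)|\le \exp\Bigl(K_2\,(1-|z|)^{-p}\prod_{j=1}^N|z-\zeta_j|^{-q_j}\Bigr),\qquad z\in\mathbb D,$$ one has $$\sum_{z\in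 Z_{f_2}}(1-|z|)^{p+1+\varepsilon}\prod_{j=1}^N|z-\zeta_j|^{(q_j-1+\varepsilon)_+}\le C\,K_2 .$$ -/

import Mathlib

/-- The zero set of `f` in the open unit disk. -/
def diskZeros (f : ℂ → ℂ) : Set ℂ :=
  {z | z ∈ Metric.ball (0 : ℂ) 1 ∧ f z = 0}

/-- The majorant `∏_j |z - ζ_j|^{-q_j}`. -/
noncomputable def growthBoundary {N : ℕ} (ζ : Fin N → ℂ) (q : Fin N → ℝ) (z : ℂ) : ℝ :=
  (∏ j, ‖z - ζ j‖ ^ q j)⁻¹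

/-- The majorant `(1 - |z|)^{-p} ∏_j |z - ζ_j|^{-q_j}`. -/
noncomputable def growthRadial {N : ℕ} (p : ℝ) (ζ : Fin N → ℂ) (q : Fin N → ℝ) (z : ℂ) : ℝ :=
  ((1 - ‖z‖) ^ p * ∏ j, ‖z - ζ j‖ ^ q j)⁻¹

/-- The weight `(1 - |z|)^s ∏_j |z - ζ_j|^{(q_j - 1 + ε)_+}` attached to a zero `z`. -/
noncomputable def zeroWeight {N : ℕ} (s ε : ℝ) (ζ : Fin N → ℂ) (q : Fin N → ℝ) (z : ℂ) : ℝ :=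
  (1 - ‖z‖) ^ s * ∏ j, ‖z - ζ j‖ ^ max (q j - 1 + ε) 0

/-- The sum of `w` over the zeros of `f` in the unit disk, counted with multiplicity, converges
and is at most `B`. -/
def ZeroSumLE (f : ℂ → ℂ) (w : ℂ → ℝ) (B : ℝ) : Prop :=
  Summable (fun z : diskZeros f => (analyticOrderNatAt f (z : ℂ) : ℝ) * w z) ∧
    ∑' z : diskZeros f, (analyticOrderNatAt f (z : ℂ) : ℝ) * w z ≤ B

open Metric Set Filter Topology

/-! Jensen's formula bounds the sum of `1 - |w|` over the zeros of `g` by circle means of `log |g|`.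
This settles a majorant `B |w - 1|^(-σ)` with `σ < 1`, whose means are uniformly bounded. Everything
else is a reduction to this case by subordination: `f` is composed with a holomorphic self-map `ψ`
of the disk fixing `0`. The zeros of `f` in the image of `ψ` lift to zeros of `f ∘ ψ` of at least
the same multiplicity (`ZeroBound.of_comp`), and `|w|² ≤ |ψ w|` gives `1 - |ψ w| ≤ 2 (1 - |w|)`, so
the weight is lost only up to a constant.

The maps have the form `w * exp (-κ u w)`, where `Re u ≥ 0` is negligible on the part of the circle
to be kept and large on the part to be avoided. Such a `u` is `√(s² + L²) - s` on the half-plane `Re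
s > 0`, whose real part vanishes on the imaginary axis beyond height `L`, transplanted by a Cayley
transform. With it, `pushMap` keeps its image at distance about `δ` from `1`. A majorant of exponent
`q = σ + τ` then costs only `δ^(-τ)`, and dyadic summation over `δ` proves the one-point theorem
`zeroBound_one_point`.

For several points, `arcMap` has an image touching the circle only near one chosen point, so at most
one singularity matters there. Compactness of the closed disk glues the local bounds. Radial growth
is reduced to boundary growth on the disks of radius `1 - 2⁻ⁿ / 4`, followed by another dyadic
summation. -/

/-! ### Zero sums and their transport under self-maps of the disk. -/

/-- Every finite partial sum of `b` over the zeros of `f` in the unit disk, counted with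
multiplicity, is at most `B`. -/
def ZeroBound (f : ℂ → ℂ) (b : ℂ → ℝ) (B : ℝ) : Prop :=
  ∀ T : Finset ℂ, (∀ z ∈ T, z ∈ ball (0 : ℂ) 1) →
    ∑ z ∈ T, (analyticOrderNatAt f z : ℝ) * b z ≤ B

theorem ZeroBound.zeroSumLE {f : ℂ → ℂ} {b : ℂ → ℝ} {B : ℝ} (h : ZeroBound f b B)
    (hb : ∀ z ∈ ball (0 : ℂ) 1, 0 ≤ b z) : ZeroSumLE f b B := by
  have h0 : ∀ z : diskZeros f, 0 ≤ (analyticOrderNatAt f (z : ℂ) : ℝ) * b z := fun z =>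
    mul_nonneg (Nat.cast_nonneg _) (hb z z.2.1)
  have h1 : ∀ u : Finset (diskZeros f),
      ∑ z ∈ u, (analyticOrderNatAt f (z : ℂ) : ℝ) * b z ≤ B := by
    intro u
    have := h (u.map (Function.Embedding.subtype _)) (by
      intro z hz
      obtain ⟨y, _, rfl⟩ := Finset.mem_map.1 hz
      exact y.2.1)
    simpa using this
  have hs := summable_of_sum_le h0 h1
  exact ⟨hs, hs.tsum_le_of_sum_le h1⟩

theorem ZeroBound.mono {f : ℂ → ℂ} {a b : ℂ → ℝ} {A B : ℝ} (h : ZeroBound f b B) (hAB : B ≤ A)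
    (hab : ∀ z ∈ ball (0 : ℂ) 1, a z ≤ b z) : ZeroBound f a A := fun T hT =>
  (Finset.sum_le_sum fun z hz =>
    mul_le_mul_of_nonneg_left (hab z (hT z hz)) (Nat.cast_nonneg _)).trans ((h T hT).trans hAB)

theorem ZeroBound.add {f : ℂ → ℂ} {a b : ℂ → ℝ} {A B : ℝ} (ha : ZeroBound f a A)
    (hb : ZeroBound f b B) : ZeroBound f (fun z => a z + b z) (A + B) := fun T hT => by
  simp only [mul_add, Finset.sum_add_distrib]
  exact add_le_add (ha T hT) (hb T hT)

theorem ZeroBound.const_mul {f : ℂ → ℂ} {a : ℂ → ℝ} {A c : ℝ} (hc : 0 ≤ c)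
    (ha : ZeroBound f a A) : ZeroBound f (fun z => c * a z) (c * A) := fun T hT => by
  simp only [mul_left_comm _ c, ← Finset.mul_sum]
  exact mul_le_mul_of_nonneg_left (ha T hT) hc

theorem analyticOrderAt_ne_top_of_norm_eq_one {f : ℂ → ℂ} (hf : AnalyticOnNhd ℂ f (ball 0 1))
    (h0 : ‖f 0‖ = 1) {z : ℂ} (hz : z ∈ ball (0 : ℂ) 1) : analyticOrderAt f z ≠ ⊤ := by
  have h00 : (0 : ℂ) ∈ ball (0 : ℂ) 1 := by simp
  refine hf.analyticOrderAt_ne_top_of_isPreconnected (convex_ball _ _).isPreconnected h00 hz ?_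
  have : f 0 ≠ 0 := by rw [← norm_ne_zero_iff, h0]; exact one_ne_zero
  rw [(hf 0 h00).analyticOrderAt_eq_zero.2 this]
  simp

/-- Zeros of `f` are transported to zeros of `f ∘ ψ`, with at least the same multiplicity. -/
theorem ZeroBound.of_comp {f ψ : ℂ → ℂ} {a b : ℂ → ℝ} {B : ℝ}
    (hf : AnalyticOnNhd ℂ f (ball 0 1)) (h0 : ‖f 0‖ = 1)
    (hψ : AnalyticOnNhd ℂ ψ (ball 0 1)) (hψm : ∀ w ∈ ball (0 : ℂ) 1, ψ w ∈ ball (0 : ℂ) 1)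
    (hψ0 : ψ 0 = 0)
    (hab : ∀ z ∈ ball (0 : ℂ) 1, a z ≤ 0 ∨ ∃ w ∈ ball (0 : ℂ) 1, ψ w = z ∧ a z ≤ b w)
    (h : ZeroBound (f ∘ ψ) b B) : ZeroBound f a B := by
  classical
  intro T hT
  have hg : AnalyticOnNhd ℂ (f ∘ ψ) (ball 0 1) := fun w hw => (hf _ (hψm w hw)).comp (hψ w hw)
  have hg0 : ‖(f ∘ ψ) 0‖ = 1 := by simp [hψ0, h0]
  have hex : ∀ z, ∃ w, (z ∈ T ∧ 0 < a z) → (w ∈ ball (0 : ℂ) 1 ∧ ψ w = z ∧ a z ≤ b w) := by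
    intro z
    by_cases hz : z ∈ T ∧ 0 < a z
    · obtain h1 | ⟨w, h1, h2, h3⟩ := hab z (hT z hz.1)
      · linarith [hz.2]
      · exact ⟨w, fun _ => ⟨h1, h2, h3⟩⟩
    · exact ⟨0, fun h => absurd h hz⟩
  choose φ hφ using hex
  have hmem : ∀ z ∈ T.filter (fun z => 0 < a z), z ∈ T ∧ 0 < a z := fun z hz => by simpa using hz
  have hinj : Set.InjOn φ (T.filter (fun z => 0 < a z)) := by
    intro z hz z' hz' he
    rw [← (hφ z (hmem z hz)).2.1, ← (hφ z' (hmem z' hz')).2.1, he]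
  calc ∑ z ∈ T, (analyticOrderNatAt f z : ℝ) * a z
      ≤ ∑ z ∈ T.filter (fun z => 0 < a z), (analyticOrderNatAt f z : ℝ) * a z := by
        rw [← Finset.sum_filter_add_sum_filter_not T (fun z => 0 < a z)]
        have : ∑ z ∈ T.filter (fun z => ¬ 0 < a z), (analyticOrderNatAt f z : ℝ) * a z ≤ 0 :=
          Finset.sum_nonpos fun z hz => mul_nonpos_of_nonneg_of_nonpos (Nat.cast_nonneg _)
            (not_lt.1 (Finset.mem_filter.1 hz).2)
        linarith
    _ ≤ ∑ z ∈ T.filter (fun z => 0 < a z),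
          (analyticOrderNatAt (f ∘ ψ) (φ z) : ℝ) * b (φ z) := by
        refine Finset.sum_le_sum fun z hz => ?_
        obtain ⟨h1, h2, h3⟩ := hφ z (hmem z hz)
        refine mul_le_mul ?_ h3 (hmem z hz).2.le (Nat.cast_nonneg _)
        have hz1 := hT z (hmem z hz).1
        have ht := analyticOrderAt_ne_top_of_norm_eq_one hf h0 hz1
        have ht' := analyticOrderAt_ne_top_of_norm_eq_one hg hg0 h1
        -- The order of a composition is the product of the order of `f` at `ψ w` and the order of
        -- `ψ - ψ w` at `w`; the latter is at least `1`.
        have hle : analyticOrderAt f z ≤ analyticOrderAt (f ∘ ψ) (φ z) := by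
          have hfa : AnalyticAt ℂ f (ψ (φ z)) := by rw [h2]; exact hf z hz1
          rw [hfa.analyticOrderAt_comp (hψ _ h1), h2]
          refine le_mul_of_one_le_right (zero_le) ?_
          rw [Order.one_le_iff_ne_zero,
            AnalyticAt.analyticOrderAt_ne_zero ((hψ _ h1).fun_sub analyticAt_const), h2, sub_self]
        rw [← Nat.cast_analyticOrderNatAt ht, ← Nat.cast_analyticOrderNatAt ht'] at hle
        exact_mod_cast hle
    _ = ∑ w ∈ (T.filter (fun z => 0 < a z)).image φ,
          (analyticOrderNatAt (f ∘ ψ) w : ℝ) * b w := (Finset.sum_image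
          (f := fun w => (analyticOrderNatAt (f ∘ ψ) w : ℝ) * b w) hinj).symm
    _ ≤ B := h _ (by
        intro w hw
        obtain ⟨z, hz, rfl⟩ := Finset.mem_image.1 hw
        exact (hφ z (hmem z hz)).1)

/-- A point whose radius is hit only well inside the disk lies in the image of `ψ`. -/
theorem exists_preimage_of_segment {ψ : ℂ → ℂ} (hψ : AnalyticOnNhd ℂ ψ (ball 0 1))
    (hψ0 : ψ 0 = 0) {z : ℂ} (hz : z ∈ ball (0 : ℂ) 1)
    (h : ∀ t ∈ Icc (0 : ℝ) 1, ∀ w ∈ ball (0 : ℂ) 1, ψ w = t * z → ‖w‖ ^ 2 ≤ ‖(t : ℂ) * z‖) :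
    ∃ w ∈ ball (0 : ℂ) 1, ψ w = z ∧ ‖w‖ ^ 2 ≤ ‖z‖ := by
  have hz1 : ‖z‖ < 1 := by simpa using hz
  set r := √‖z‖ with hr
  have hr0 : 0 ≤ r := Real.sqrt_nonneg _
  have hrr : r ^ 2 = ‖z‖ := Real.sq_sqrt (norm_nonneg _)
  have hr1 : r < 1 := by nlinarith
  have hsub : closedBall (0 : ℂ) r ⊆ ball 0 1 := closedBall_subset_ball hr1
  have key : ∀ t ∈ Icc (0 : ℝ) 1, ∀ w ∈ ball (0 : ℂ) 1, ψ w = t * z → ‖w‖ ≤ r := by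
    intro t ht w hw hwt
    have h1 := h t ht w hw hwt
    rw [norm_mul, Complex.norm_real, Real.norm_of_nonneg ht.1] at h1
    have h2 : t * ‖z‖ ≤ ‖z‖ := mul_le_of_le_one_left (norm_nonneg _) ht.2
    exact Real.le_sqrt_of_sq_le (h1.trans h2)
  have hopen : ∀ s ⊆ ball (0 : ℂ) 1, IsOpen s → IsOpen (ψ '' s) := by
    refine (hψ.is_constant_or_isOpen (convex_ball _ _).isPreconnected).resolve_left ?_
    rintro ⟨c, hc⟩
    have hc0 : c = 0 := by rw [← hc 0 (by simp), hψ0]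
    -- A constant `ψ` would send this point, of norm greater than `r`, to `0`, against `key` at `t =
    -- 0`.
    have hm : (((1 + r) / 2 : ℝ) : ℂ) ∈ ball (0 : ℂ) 1 := by
      rw [mem_ball_zero_iff, Complex.norm_real, Real.norm_of_nonneg (by positivity)]
      linarith
    have := key 0 (by simp) _ hm (by rw [hc _ hm, hc0]; simp)
    rw [Complex.norm_real, Real.norm_of_nonneg (by positivity)] at this
    linarith
  let S := (fun t : ℝ => (t : ℂ) * z) '' Icc (0 : ℝ) 1
  have hS : IsPreconnected S :=
    isPreconnected_Icc.image _ (by fun_prop)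
  have hcl : IsClosed (ψ '' closedBall (0 : ℂ) r) :=
    ((isCompact_closedBall _ _).image_of_continuousOn
      (hψ.continuousOn.mono hsub)).isClosed
  have hop : IsOpen (ψ '' ball (0 : ℂ) 1) := hopen _ subset_rfl isOpen_ball
  -- On the segment `[0, z]` the images of the open unit disk and of the closed disk of radius `r`
  -- agree. Hence the image meets the segment in a relatively open and closed set containing `0`,
  -- and connectedness gives `z`.
  have hmem : z ∈ ψ '' ball (0 : ℂ) 1 := by
    by_contra hcon
    obtain ⟨y, ⟨t, ht, hty⟩, ⟨w, hw, hwy⟩, hyv⟩ :=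
      hS (ψ '' ball (0 : ℂ) 1) (ψ '' closedBall (0 : ℂ) r)ᶜ hop hcl.isOpen_compl
        (by
          rintro y -
          by_cases hy : y ∈ ψ '' closedBall (0 : ℂ) r
          · exact Or.inl (image_mono hsub hy)
          · exact Or.inr hy)
        ⟨0, ⟨0, by simp, by simp⟩, ⟨0, by simp, hψ0⟩⟩
        ⟨z, ⟨1, by simp, by simp⟩, fun hy => hcon (image_mono hsub hy)⟩
    exact hyv ⟨w, by simpa using key t ht w hw (hwy.trans hty.symm), hwy⟩
  obtain ⟨w, hw, hwz⟩ := hmem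
  refine ⟨w, hw, hwz, ?_⟩
  simpa using h 1 (by simp) w hw (by simp [hwz])

/-! ### Jensen's inequality with an integrable singularity. -/

theorem intervalIntegrable_rpow_neg_add {σ : ℝ} (hσ1 : σ < 1) :
    IntervalIntegrable (fun θ : ℝ => (θ / Real.pi) ^ (-σ) + ((2 * Real.pi - θ) / Real.pi) ^ (-σ))
      MeasureTheory.volume 0 (2 * Real.pi) := by
  have h : IntervalIntegrable (fun x : ℝ => x ^ (-σ)) MeasureTheory.volume 0 2 :=
    intervalIntegral.intervalIntegrable_rpow' (by linarith)
  have h1 : IntervalIntegrable (fun θ : ℝ => (θ / Real.pi) ^ (-σ)) MeasureTheory.volume 0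
      (2 * Real.pi) := by
    have := h.comp_mul_right (c := Real.pi⁻¹) 
    simpa [div_eq_mul_inv] using this
  refine h1.add ?_
  simpa using (h1.comp_sub_left (2 * Real.pi)).symm

/-- Both sides are separated by `sin (θ / 2)`: Jordan's inequality bounds it below, and `R² + 1 - 2
R cos θ ≥ sin² (θ / 2)` holds for every radius. Uniformity in `R` is what allows `R → 1` later. -/
theorem half_angle_le_norm_circleMap_sub_one {R θ : ℝ} (hR : 0 ≤ R) (hR1 : R ≤ 1)
    (hθ : θ ∈ Ioo 0 (2 * Real.pi)) :
    min (θ / Real.pi) ((2 * Real.pi - θ) / Real.pi) ≤ ‖circleMap 0 R θ - 1‖ := by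
  have hπ := Real.pi_pos
  have hmin : min (θ / Real.pi) ((2 * Real.pi - θ) / Real.pi) ≤ Real.sin (θ / 2) := by
    rcases le_total θ Real.pi with h | h
    · refine (min_le_left _ _).trans ?_
      have := Real.mul_le_sin (x := θ / 2) (by linarith [hθ.1]) (by linarith)
      exact le_trans (le_of_eq (by ring)) this
    · refine (min_le_right _ _).trans ?_
      have := Real.mul_le_sin (x := Real.pi - θ / 2) (by linarith [hθ.2]) (by linarith)
      rw [Real.sin_pi_sub] at this
      exact le_trans (le_of_eq (by field_simp)) this
  refine hmin.trans ?_
  have hs0 : 0 ≤ Real.sin (θ / 2) :=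
    Real.sin_nonneg_of_nonneg_of_le_pi (by linarith [hθ.1]) (by linarith [hθ.2])
  refine abs_le_of_sq_le_sq' ?_ (norm_nonneg _) |>.2
  have hsq : ‖circleMap 0 R θ - 1‖ ^ 2 = R ^ 2 + 1 - 2 * R * Real.cos θ := by
    rw [← Complex.normSq_eq_norm_sq, Complex.normSq_apply]
    simp [circleMap, Complex.exp_ofReal_mul_I_re, Complex.exp_ofReal_mul_I_im]
    nlinarith [Real.sin_sq_add_cos_sq θ]
  have hcos : Real.cos θ = 1 - 2 * Real.sin (θ / 2) ^ 2 := by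
    have := Real.cos_two_mul (θ / 2)
    rw [mul_div_cancel₀ θ two_ne_zero] at this
    linarith [Real.sin_sq_add_cos_sq (θ / 2)]
  rw [hsq, hcos]
  nlinarith [Real.sin_sq_le_one (θ / 2), sq_nonneg (1 - R - Real.sin (θ / 2)),
    sq_nonneg (R - 1 + 2 * Real.sin (θ / 2) ^ 2), sq_nonneg (Real.sin (θ / 2)),
    mul_nonneg hR (sq_nonneg (Real.sin (θ / 2)))]

/-- The mean of `|w - 1| ^ (-σ)` over circles is bounded in the unit disk for `σ < 1`. -/
noncomputable def circleConst (σ : ℝ) : ℝ :=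
  (2 * Real.pi)⁻¹ * ∫ θ in (0 : ℝ)..(2 * Real.pi),
    ((θ / Real.pi) ^ (-σ) + ((2 * Real.pi - θ) / Real.pi) ^ (-σ))

theorem circleConst_nonneg (σ : ℝ) : 0 ≤ circleConst σ := by
  have hπ := Real.pi_pos
  refine mul_nonneg (by positivity) (intervalIntegral.integral_nonneg (by positivity) ?_)
  intro θ hθ
  have : 0 ≤ 2 * Real.pi - θ := by linarith [hθ.2]
  have := hθ.1
  positivity

theorem circleAverage_le_circleConst {u : ℂ → ℝ} {R σ B : ℝ} (hR : 0 ≤ R) (hR1 : R < 1)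
    (hσ0 : 0 ≤ σ) (hσ1 : σ < 1) (hB : 0 ≤ B) (hu : CircleIntegrable u 0 R)
    (h : ∀ w ∈ ball (0 : ℂ) 1, u w ≤ B * ‖w - 1‖ ^ (-σ)) :
    Real.circleAverage u 0 R ≤ B * circleConst σ := by
  have hπ := Real.pi_pos
  rw [Real.circleAverage_def, circleConst, smul_eq_mul, mul_left_comm B,
    ← intervalIntegral.integral_const_mul B]
  have h2π : 0 ≤ (2 * Real.pi)⁻¹ := by positivity
  refine mul_le_mul_of_nonneg_left ?_ h2π
  refine intervalIntegral.integral_mono_on_of_le_Ioo (by positivity) hu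
    ((intervalIntegrable_rpow_neg_add hσ1).const_mul B) fun θ hθ => ?_
  have hw : circleMap 0 R θ ∈ ball (0 : ℂ) 1 := by
    simpa [abs_of_nonneg hR] using hR1
  refine (h _ hw).trans (mul_le_mul_of_nonneg_left ?_ hB)
  have h1 : 0 < θ / Real.pi := div_pos hθ.1 hπ
  have h2 : 0 < (2 * Real.pi - θ) / Real.pi := div_pos (by linarith [hθ.2]) hπ
  have hmin := half_angle_le_norm_circleMap_sub_one hR hR1.le hθ
  refine (Real.rpow_le_rpow_of_nonpos (lt_min h1 h2) hmin (by linarith)).trans ?_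
  have p1 : 0 ≤ (θ / Real.pi) ^ (-σ) := by positivity
  have p2 : 0 ≤ ((2 * Real.pi - θ) / Real.pi) ^ (-σ) := by positivity
  rcases min_choice (θ / Real.pi) ((2 * Real.pi - θ) / Real.pi) with e | e <;> rw [e] <;> linarith

/-- **Jensen's inequality** for a majorant with an integrable boundary singularity. -/
theorem zeroBound_of_integrable_growth {g : ℂ → ℂ} {σ B : ℝ}
    (hg : AnalyticOnNhd ℂ g (ball 0 1)) (h0 : ‖g 0‖ = 1) (hσ0 : 0 ≤ σ) (hσ1 : σ < 1) (hB : 0 ≤ B)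
    (h : ∀ w ∈ ball (0 : ℂ) 1, ‖g w‖ ≤ Real.exp (B * ‖w - 1‖ ^ (-σ))) :
    ZeroBound g (fun w => 1 - ‖w‖) (B * circleConst σ) := by
  intro T hT
  have hg0 : g 0 ≠ 0 := by rw [← norm_ne_zero_iff, h0]; exact one_ne_zero
  have key : ∀ R : ℝ, 0 < R → R < 1 → (∀ w ∈ T, ‖w‖ < R) →
      ∑ w ∈ T, (analyticOrderNatAt g w : ℝ) * (1 - ‖w‖ / R) ≤ B * circleConst σ := by
    intro R hR hR1 hTR
    have hcb : closedBall (0 : ℂ) |R| ⊆ ball 0 1 :=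
      closedBall_subset_ball (by rwa [abs_of_pos hR])
    have hgR := hg.mono hcb
    have hJ := hgR.circleAverage_log_norm hR.ne' hg0
    rw [h0, Real.log_one, add_zero] at hJ
    have hup := circleAverage_le_circleConst hR.le hR1 hσ0 hσ1 hB
      (u := fun w => Real.log ‖g w‖)
      (hgR.mono sphere_subset_closedBall).meromorphicOn.circleIntegrable_log_norm (by
        intro w hw
        rcases eq_or_ne (g w) 0 with hz | hz
        -- At a zero `Real.log 0 = 0`, so nonnegativity of the majorant suffices.
        · rw [hz, norm_zero, Real.log_zero]; positivity
        · rw [Real.log_le_iff_le_exp (norm_pos_iff.2 hz)]; exact h w hw)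
    rw [hJ] at hup
    refine le_trans ?_ hup
    have hfin := (MeromorphicOn.divisor g (closedBall (0 : ℂ) |R|)).finiteSupport
      (isCompact_closedBall _ _)
    have hord : ∀ u ∈ closedBall (0 : ℂ) |R|,
        ((MeromorphicOn.divisor g (closedBall (0 : ℂ) |R|) u : ℤ) : ℝ)
          = analyticOrderNatAt g u := by
      intro u hu
      rw [MeromorphicOn.AnalyticOnNhd.divisor_apply hgR hu]
      have ht := analyticOrderAt_ne_top_of_norm_eq_one hg h0 (hcb hu)
      rw [← Nat.cast_analyticOrderNatAt ht]
      simp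
    have hnn : ∀ u, 0 ≤ ((MeromorphicOn.divisor g (closedBall (0 : ℂ) |R|) u : ℤ) : ℝ)
        * Real.log (R * ‖0 - u‖⁻¹) := by
      intro u
      by_cases hu : u ∈ closedBall (0 : ℂ) |R|
      · rw [hord u hu]
        rcases eq_or_ne u 0 with rfl | hu0
        · simp
        refine mul_nonneg (Nat.cast_nonneg _) (Real.log_nonneg ?_)
        have hun : 0 < ‖u‖ := norm_pos_iff.2 hu0
        rw [zero_sub, norm_neg, ← div_eq_mul_inv, one_le_div hun]
        simpa [abs_of_pos hR] using hu
      · rw [Function.locallyFinsuppWithin.apply_eq_zero_of_notMem _ hu]; simp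
    have hsupp : (Function.support fun u =>
        ((MeromorphicOn.divisor g (closedBall (0 : ℂ) |R|) u : ℤ) : ℝ)
          * Real.log (R * ‖0 - u‖⁻¹)) ⊆ hfin.toFinset := by
      intro u hu
      simp only [Function.mem_support] at hu
      have := left_ne_zero_of_mul hu
      simpa using this
    classical
    rw [finsum_eq_sum_of_support_subset _
      (hsupp.trans (Finset.coe_subset.2 (Finset.subset_union_left (s₂ := T))))]
    calc _ ≤ ∑ u ∈ T, ((MeromorphicOn.divisor g (closedBall (0 : ℂ) |R|) u : ℤ) : ℝ)
          * Real.log (R * ‖0 - u‖⁻¹) := by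
          refine Finset.sum_le_sum fun w hw => ?_
          have hwR := hTR w hw
          rw [hord w (by simpa [abs_of_pos hR] using hwR.le)]
          rcases eq_or_ne w 0 with rfl | hw0
          · have : analyticOrderNatAt g 0 = 0 := by
              by_contra hne
              exact hg0 (apply_eq_zero_of_analyticOrderNatAt_ne_zero hne)
            simp [this]
          refine mul_le_mul_of_nonneg_left ?_ (Nat.cast_nonneg _)
          have hwn : 0 < ‖w‖ := norm_pos_iff.2 hw0
          -- A zero contributes `log (R / |w|) ≥ 1 - |w| / R`.
          have := Real.one_sub_inv_le_log_of_pos (x := R * ‖w‖⁻¹) (by positivity)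
          rw [zero_sub, norm_neg]
          refine le_trans (le_of_eq ?_) this
          field_simp
      _ ≤ _ := Finset.sum_le_sum_of_subset_of_nonneg Finset.subset_union_right
          fun u _ _ => hnn u
  have hlim : Tendsto (fun R : ℝ => ∑ w ∈ T, (analyticOrderNatAt g w : ℝ) * (1 - ‖w‖ / R))
      (𝓝[<] 1) (𝓝 (∑ w ∈ T, (analyticOrderNatAt g w : ℝ) * (1 - ‖w‖ / 1))) := by
    refine tendsto_finsetSum _ fun w _ => ?_
    refine (((tendsto_const_nhds.div tendsto_id one_ne_zero).const_sub 1).const_mul _).mono_left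
      nhdsWithin_le_nhds
  simp only [div_one] at hlim
  refine le_of_tendsto hlim ?_
  have hev : ∀ᶠ R : ℝ in 𝓝[<] 1, ∀ w ∈ T, ‖w‖ < R := by
    rw [Finset.eventually_all]
    intro w hw
    exact mem_of_superset (Ioo_mem_nhdsLT (by simpa using hT w hw)) fun R hR => hR.1
  filter_upwards [hev, Ioo_mem_nhdsLT (zero_lt_one' ℝ)] with R h1 h2
  exact key R h2.1 h2.2 h1

/-! ### Dyadic summation. -/

/-- Dyadic summation: bounds for the parts `2⁻ⁿ ≤ d` with loss `2 ^ (n τ)` give the weight `d ^ s`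
for `s > τ`. -/
theorem sum_rpow_le_of_dyadic {ι : Type*} (T : Finset ι) (a d : ι → ℝ) {B τ s : ℝ}
    (ha : ∀ i ∈ T, 0 ≤ a i) (hd0 : ∀ i ∈ T, 0 < d i) (hd2 : ∀ i ∈ T, d i ≤ 2)
    (hs : 0 ≤ s) (hτ : τ < s) (hB : 0 ≤ B)
    (h : ∀ n : ℕ, ∑ i ∈ T.filter (fun i => (2 : ℝ)⁻¹ ^ n ≤ d i), a i ≤ B * (2 ^ τ) ^ n) :
    ∑ i ∈ T, a i * d i ^ s ≤ 4 ^ s * (1 - 2 ^ (τ - s))⁻¹ * B := by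
  set x : ℝ := 2 ^ (τ - s) with hx
  have hx0 : 0 < x := by positivity
  have hx1 : x < 1 := Real.rpow_lt_one_of_one_lt_of_neg (by norm_num) (by linarith)
  have hn : ∀ i ∈ T, ∃ n : ℕ, (2 : ℝ)⁻¹ ^ n ≤ d i ∧ d i ≤ 4 * (2 : ℝ)⁻¹ ^ n := by
    intro i hi
    rcases lt_or_ge 1 (d i) with h1 | h1
    · exact ⟨0, by simpa using h1.le, by simpa using (hd2 i hi).trans (by norm_num)⟩
    · obtain ⟨n, h2, h3⟩ := exists_nat_pow_near_of_lt_one (hd0 i hi) h1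
        (y := (2 : ℝ)⁻¹) (by norm_num) (by norm_num)
      refine ⟨n + 1, h2.le, h3.trans ?_⟩
      rw [pow_succ]
      nlinarith [show (0 : ℝ) < 2⁻¹ ^ n by positivity]
  choose! ν hν using hn
  obtain ⟨M, hM⟩ : ∃ M : ℕ, ∀ i ∈ T, ν i < M :=
    ⟨T.sup ν + 1, fun i hi => Nat.lt_succ_of_le (Finset.le_sup hi)⟩
  -- Only the term `n = ν i` is needed, since there `d i ^ s ≤ 4 ^ s * 2 ^ (-s n)`. Exchanging the
  -- sums leaves a geometric series of ratio `2 ^ (τ - s)`.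
  have hpt : ∀ i ∈ T, a i * d i ^ s ≤ ∑ n ∈ Finset.range M,
      4 ^ s * ((2 : ℝ) ^ (-s)) ^ n * (if (2 : ℝ)⁻¹ ^ n ≤ d i then a i else 0) := by
    intro i hi
    have hai := ha i hi
    refine le_trans ?_ (Finset.single_le_sum (f := fun n => 4 ^ s * ((2 : ℝ) ^ (-s)) ^ n *
      (if (2 : ℝ)⁻¹ ^ n ≤ d i then a i else 0)) (fun n _ => ?_) (Finset.mem_range.2 (hM i hi)))
    · simp only [(hν i hi).1, if_true]
      rw [mul_comm]
      refine mul_le_mul_of_nonneg_right ?_ hai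
      refine (Real.rpow_le_rpow (hd0 i hi).le (hν i hi).2 hs).trans (le_of_eq ?_)
      rw [Real.mul_rpow (by norm_num) (by positivity), Real.rpow_neg (by norm_num),
        ← Real.inv_rpow (by norm_num), ← Real.rpow_natCast, ← Real.rpow_natCast,
        ← Real.rpow_mul (by norm_num), ← Real.rpow_mul (by norm_num), mul_comm s]
    · split_ifs <;> positivity
  calc ∑ i ∈ T, a i * d i ^ s
      ≤ ∑ i ∈ T, ∑ n ∈ Finset.range M, 4 ^ s * ((2 : ℝ) ^ (-s)) ^ n *
          (if (2 : ℝ)⁻¹ ^ n ≤ d i then a i else 0) := Finset.sum_le_sum hpt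
    _ = ∑ n ∈ Finset.range M, 4 ^ s * ((2 : ℝ) ^ (-s)) ^ n *
          ∑ i ∈ T.filter (fun i => (2 : ℝ)⁻¹ ^ n ≤ d i), a i := by
        rw [Finset.sum_comm]
        simp only [Finset.sum_filter, Finset.mul_sum]
    _ ≤ ∑ n ∈ Finset.range M, 4 ^ s * ((2 : ℝ) ^ (-s)) ^ n * (B * (2 ^ τ) ^ n) :=
        Finset.sum_le_sum fun n _ => mul_le_mul_of_nonneg_left (h n) (by positivity)
    _ = 4 ^ s * B * ∑ n ∈ Finset.range M, x ^ n := by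
        rw [Finset.mul_sum]
        refine Finset.sum_congr rfl fun n _ => ?_
        rw [hx, sub_eq_add_neg, Real.rpow_add (by norm_num), mul_pow]
        ring
    _ ≤ 4 ^ s * B * (1 - x)⁻¹ := by
        refine mul_le_mul_of_nonneg_left ?_ (by positivity)
        rw [← tsum_geometric_of_lt_one hx0.le hx1]
        exact (summable_geometric_of_lt_one hx0.le hx1).sum_le_tsum _ fun n _ => by positivity
    _ = _ := by ring

/-! ### The bump function on the half-plane and on the disk. -/

/-- The branch of `√(s² + L²) - s` on the right half-plane. -/
noncomputable def sqrtGap (L : ℝ) (s : ℂ) : ℂ := (s ^ 2 + (L : ℂ) ^ 2) ^ (1 / 2 : ℂ) - s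

theorem sq_add_sq_mem_slitPlane {L : ℝ} {s : ℂ} (hs : 0 < s.re) :
    s ^ 2 + (L : ℂ) ^ 2 ∈ Complex.slitPlane := by
  rw [Complex.mem_slitPlane_iff]
  by_cases hy : s.im = 0
  · left
    simp [pow_two, hy]
    nlinarith [mul_pos hs hs, mul_self_nonneg L]
  · right
    simp [pow_two]
    intro h
    have : s.re * s.im = 0 := by linarith
    rcases mul_eq_zero.1 this with h | h
    · exact hs.ne' h
    · exact hy h

/-- Here `X + iY` is the principal root; its argument lies strictly between `-π/2` and `π/2`, whence
`X > 0`. -/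
theorem sqrtGap_spec {L : ℝ} {s : ℂ} (hs : 0 < s.re) :
    ∃ X Y : ℝ, 0 < X ∧ X ^ 2 - Y ^ 2 = s.re ^ 2 - s.im ^ 2 + L ^ 2 ∧ X * Y = s.re * s.im ∧
      (sqrtGap L s).re = X - s.re ∧ (sqrtGap L s).im = Y - s.im := by
  have hsl := sq_add_sq_mem_slitPlane (L := L) hs
  set u := s ^ 2 + (L : ℂ) ^ 2 with hu
  have hu0 : u ≠ 0 := Complex.slitPlane_ne_zero hsl
  have hR : (u ^ (1 / 2 : ℂ)) ^ 2 = u := by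
    rw [← Complex.cpow_nat_mul]; norm_num
  refine ⟨(u ^ (1 / 2 : ℂ)).re, (u ^ (1 / 2 : ℂ)).im, ?_, ?_, ?_, rfl, rfl⟩
  · rw [Complex.cpow_def_of_ne_zero hu0, Complex.exp_re]
    refine mul_pos (Real.exp_pos _) (Real.cos_pos_of_mem_Ioo ?_)
    have h1 := Complex.neg_pi_lt_arg u
    have h2 : u.arg < Real.pi := lt_of_le_of_ne (Complex.arg_le_pi u)
      (Complex.mem_slitPlane_iff_arg.1 hsl).1
    have : (Complex.log u * (1 / 2)).im = u.arg / 2 := by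
      simp [Complex.log_im]
      ring
    rw [this]
    constructor <;> linarith
  · have := congrArg Complex.re hR
    rw [hu] at this ⊢
    simp [pow_two] at this ⊢
    linarith
  · have := congrArg Complex.im hR
    rw [hu] at this ⊢
    simp [pow_two] at this ⊢
    linarith

/-- The product relation makes `|Y|` shrink when `X` grows past `x`, and conversely; a violation of
either bound on `X` then contradicts the difference of squares. -/
theorem sqrt_components_bounds {X Y x y L : ℝ} (hL : 0 < L) (hX : 0 < X) (hx : 0 < x)
    (h1 : X ^ 2 - Y ^ 2 = x ^ 2 - y ^ 2 + L ^ 2) (h2 : X * Y = x * y) :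
    x ≤ X ∧ 0 ≤ y * Y ∧ (4 * L ^ 2 ≤ x ^ 2 + y ^ 2 → X ≤ 2 * x) := by
  have hsq : X ^ 2 * Y ^ 2 = x ^ 2 * y ^ 2 := by
    rw [← mul_pow, h2, mul_pow]
  have hX2 : 0 < X ^ 2 := by positivity
  have hx2 : 0 < x ^ 2 := by positivity
  have hL2 : 0 < L ^ 2 := by positivity
  refine ⟨?_, ?_, fun h => ?_⟩
  · by_contra hlt
    push Not at hlt
    have h3 : X ^ 2 < x ^ 2 := by nlinarith
    have h4 : X ^ 2 * y ^ 2 ≤ X ^ 2 * Y ^ 2 := by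
      rw [hsq]; exact mul_le_mul_of_nonneg_right h3.le (sq_nonneg y)
    have : y ^ 2 ≤ Y ^ 2 := le_of_mul_le_mul_left h4 hX2
    linarith
  · have : 0 ≤ X * (y * Y) := by
      rw [show X * (y * Y) = (X * Y) * y by ring, h2, mul_assoc]
      exact mul_nonneg hx.le (mul_self_nonneg y)
    exact nonneg_of_mul_nonneg_right this hX
  · by_contra hlt
    push Not at hlt
    have h4 : 4 * x ^ 2 ≤ X ^ 2 := by nlinarith
    have h5 : x ^ 2 * (4 * Y ^ 2) ≤ x ^ 2 * y ^ 2 := by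
      rw [← hsq]; linarith [mul_le_mul_of_nonneg_right h4 (sq_nonneg Y)]
    have h6 : 4 * Y ^ 2 ≤ y ^ 2 := le_of_mul_le_mul_left h5 hx2
    linarith [sq_nonneg y]

/-- With `R = X + iY`, everything rests on `(R - s)(R + s) = L²`. Since `X ≥ x` and `yY ≥ 0`, the
factor `|R + s|` dominates both `|R - s|` and `|s|`. Taking real parts gives `Re (R - s) = L² Re (R
+ s) / |R + s|²`, small when `Re s` is small and `|s|` large. -/
theorem sqrtGap_bounds {L : ℝ} (hL : 0 < L) {s : ℂ} (hs : 0 < s.re) :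
    0 ≤ (sqrtGap L s).re ∧ ‖sqrtGap L s‖ ≤ L ∧ ‖sqrtGap L s‖ * ‖s‖ ≤ L ^ 2 ∧
      (2 * L ≤ ‖s‖ → (sqrtGap L s).re * ‖s‖ ^ 2 ≤ 3 * L ^ 2 * s.re) ∧
      (3 * ‖s‖ ≤ L → L / 2 ≤ (sqrtGap L s).re) := by
  obtain ⟨X, Y, hX, h1, h2, hre, him⟩ := sqrtGap_spec (L := L) hs
  have hns : ‖s‖ ^ 2 = s.re ^ 2 + s.im ^ 2 := by
    rw [← Complex.normSq_eq_norm_sq, Complex.normSq_apply]; ring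
  have hnG : ‖sqrtGap L s‖ ^ 2 = (X - s.re) ^ 2 + (Y - s.im) ^ 2 := by
    rw [← Complex.normSq_eq_norm_sq, Complex.normSq_apply, hre, him]; ring
  rw [hre]
  set x := s.re
  set y := s.im
  obtain ⟨hXx, hyY, hXx2⟩ := sqrt_components_bounds hL hX hs h1 h2
  have hxX : 0 ≤ x * X := (mul_pos hs hX).le
  set P := (X + x) ^ 2 + (Y + y) ^ 2 with hP
  have hprod : ‖sqrtGap L s‖ ^ 2 * P = L ^ 4 := by
    have e : ((X - x) ^ 2 + (Y - y) ^ 2) * ((X + x) ^ 2 + (Y + y) ^ 2)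
        = (X ^ 2 - Y ^ 2 - (x ^ 2 - y ^ 2)) ^ 2 + 4 * (X * Y - x * y) ^ 2 := by ring
    rw [hnG, hP, e, h1, h2]; ring
  have hG0 := norm_nonneg (sqrtGap L s)
  have hPs : ‖s‖ ^ 2 ≤ P := by rw [hns, hP]; nlinarith [sq_nonneg X, sq_nonneg Y]
  have hPG : ‖sqrtGap L s‖ ^ 2 ≤ P := by rw [hnG, hP]; nlinarith
  have hreP : (X - x) * P = L ^ 2 * (X + x) := by
    have e : (X - x) * ((X + x) ^ 2 + (Y + y) ^ 2)
        = (X + x) * (X ^ 2 - Y ^ 2 - (x ^ 2 - y ^ 2)) + 2 * (Y + y) * (X * Y - x * y) := by ring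
    rw [hP, e, h1, h2]; ring
  refine ⟨by linarith, ?_, ?_, ?_, ?_⟩
  · have : ‖sqrtGap L s‖ ^ 4 ≤ L ^ 4 := by
      calc ‖sqrtGap L s‖ ^ 4 = ‖sqrtGap L s‖ ^ 2 * ‖sqrtGap L s‖ ^ 2 := by ring
        _ ≤ ‖sqrtGap L s‖ ^ 2 * P := mul_le_mul_of_nonneg_left hPG (sq_nonneg _)
        _ = _ := hprod
    exact le_of_pow_le_pow_left₀ (by norm_num) hL.le this
  · refine le_of_pow_le_pow_left₀ two_ne_zero (by positivity) ?_
    rw [mul_pow]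
    calc _ ≤ ‖sqrtGap L s‖ ^ 2 * P := mul_le_mul_of_nonneg_left hPs (sq_nonneg _)
      _ = (L ^ 2) ^ 2 := by rw [hprod]; ring
  · intro h
    have hX2 : X ≤ 2 * x := hXx2 (by
      rw [← hns]
      calc 4 * L ^ 2 = (2 * L) ^ 2 := by ring
        _ ≤ _ := pow_le_pow_left₀ (by positivity) h 2)
    calc (X - x) * ‖s‖ ^ 2 ≤ (X - x) * P := mul_le_mul_of_nonneg_left hPs (by linarith)
      _ = L ^ 2 * (X + x) := hreP
      _ ≤ L ^ 2 * (3 * x) := mul_le_mul_of_nonneg_left (by linarith) (sq_nonneg L)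
      _ = 3 * L ^ 2 * x := by ring
  · intro h
    clear hP hprod hPs hPG hreP hXx2
    have hns2 : 9 * ‖s‖ ^ 2 ≤ L ^ 2 := by nlinarith [norm_nonneg s]
    have hxs : 3 * x ≤ L := by nlinarith [sq_nonneg y]
    by_contra hlt
    push Not at hlt
    have h3 : X < 5 / 6 * L := by linarith
    have h4 : X ^ 2 < (5 / 6 * L) ^ 2 := pow_lt_pow_left₀ h3 hX.le two_ne_zero
    linarith [sq_nonneg Y, sq_nonneg x, pow_pos hL 2, mul_pow (5 / 6) L 2]

theorem sqrtGap_analyticAt {L : ℝ} {s : ℂ} (hs : 0 < s.re) : AnalyticAt ℂ (sqrtGap L) s := by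
  unfold sqrtGap
  have := sq_add_sq_mem_slitPlane (L := L) hs
  fun_prop (disch := assumption)

/-- The holomorphic function on the disk whose real part vanishes on the circle away from an arc of
size `L` about `1`. -/
noncomputable def arcBump (L : ℝ) (w : ℂ) : ℂ := sqrtGap L ((1 - w) / (1 + w))

theorem one_add_ne_zero_of_mem_ball {w : ℂ} (hw : w ∈ ball (0 : ℂ) 1) : 1 + w ≠ 0 := by
  intro h
  have : w = -1 := by linear_combination h
  simp [this] at hw

theorem cayley_re (w : ℂ) :
    ((1 - w) / (1 + w)).re = (1 - ‖w‖ ^ 2) / ‖1 + w‖ ^ 2 := by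
  rw [Complex.div_re, ← Complex.normSq_eq_norm_sq, ← Complex.normSq_eq_norm_sq,
    ← add_div, Complex.normSq_apply w]
  congr 1
  simp
  ring

theorem cayley_re_pos {w : ℂ} (hw : w ∈ ball (0 : ℂ) 1) : 0 < ((1 - w) / (1 + w)).re := by
  rw [cayley_re]
  have h1 := norm_pos_iff.2 (one_add_ne_zero_of_mem_ball hw)
  have h2 : ‖w‖ < 1 := by simpa using hw
  have : 0 < 1 - ‖w‖ ^ 2 := by nlinarith [norm_nonneg w]
  positivity

theorem arcBump_analyticOnNhd (L : ℝ) : AnalyticOnNhd ℂ (arcBump L) (ball 0 1) := fun w hw => by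
  have := one_add_ne_zero_of_mem_ball hw
  exact (sqrtGap_analyticAt (cayley_re_pos hw)).comp_of_eq
    (f := fun w => (1 - w) / (1 + w)) (by fun_prop (disch := assumption)) rfl

/-- This is `sqrtGap_bounds` at `s = (1 - w) / (1 + w)`. The fourth bound keeps the real part below
a multiple of `1 - |w|²` away from the arc; the fifth keeps it large near `1`. -/
theorem arcBump_bounds {L : ℝ} (hL : 0 < L) {w : ℂ} (hw : w ∈ ball (0 : ℂ) 1) :
    0 ≤ (arcBump L w).re ∧ ‖arcBump L w‖ ≤ L ∧ ‖arcBump L w‖ * ‖1 - w‖ ≤ L ^ 2 * ‖1 + w‖ ∧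
      (2 * L * ‖1 + w‖ ≤ ‖1 - w‖ →
        (arcBump L w).re * ‖1 - w‖ ^ 2 ≤ 3 * L ^ 2 * (1 - ‖w‖ ^ 2)) ∧
      (3 * ‖1 - w‖ ≤ L * ‖1 + w‖ → L / 2 ≤ (arcBump L w).re) := by
  have hp := norm_pos_iff.2 (one_add_ne_zero_of_mem_ball hw)
  obtain ⟨h1, h2, h3, h4, h5⟩ := sqrtGap_bounds hL (cayley_re_pos hw)
  rw [cayley_re] at h4
  rw [norm_div] at h3 h4 h5
  refine ⟨h1, h2, ?_, ?_, ?_⟩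
  · rwa [← mul_div_assoc, div_le_iff₀ hp] at h3
  · intro h
    have := h4 (by rwa [le_div_iff₀ hp])
    rwa [div_pow, ← mul_div_assoc, ← mul_div_assoc, div_le_div_iff_of_pos_right (by positivity)]
      at this
  · intro h
    exact h5 (by rwa [← mul_div_assoc, div_le_iff₀ hp])

/-! ### Self-maps `w * exp (-κ u)` and pushing away from the point `1`. -/

theorem norm_exp_neg_mul {κ : ℝ} (u : ℂ) : ‖Complex.exp (-(κ * u))‖ = Real.exp (-(κ * u.re)) := by
  rw [Complex.norm_exp]; simp

theorem norm_mul_exp_sub_le {κ : ℝ} (hκ : 0 ≤ κ) {u w : ℂ} (hw : w ∈ ball (0 : ℂ) 1)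
    (hu : κ * ‖u‖ ≤ 1) : ‖w * Complex.exp (-(κ * u)) - w‖ ≤ 2 * (κ * ‖u‖) := by
  have hn : ‖-((κ : ℂ) * u)‖ = κ * ‖u‖ := by
    rw [norm_neg, norm_mul, Complex.norm_real, Real.norm_of_nonneg hκ]
  have h1 := Complex.norm_exp_sub_one_le (x := -((κ : ℂ) * u)) (by rwa [hn])
  rw [hn] at h1
  have h2 : ‖w‖ ≤ 1 := by simpa using (mem_ball_zero_iff.1 hw).le
  rw [show w * Complex.exp (-(κ * u)) - w = w * (Complex.exp (-(κ * u)) - 1) by ring, norm_mul]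
  exact (mul_le_of_le_one_left (norm_nonneg _) h2).trans h1

theorem norm_mul_exp_le {κ : ℝ} (hκ : 0 ≤ κ) {u w : ℂ} (hu : 0 ≤ u.re) :
    ‖w * Complex.exp (-(κ * u))‖ ≤ ‖w‖ := by
  rw [norm_mul, norm_exp_neg_mul]
  exact mul_le_of_le_one_right (norm_nonneg _) (Real.exp_le_one_iff.2 (by
    have := mul_nonneg hκ hu; linarith))

theorem norm_mul_exp_le_one_sub {κ a : ℝ} {u w : ℂ} (hw : w ∈ ball (0 : ℂ) 1)
    (ha0 : 0 ≤ a) (ha : a ≤ 1) (hu : a ≤ κ * u.re) :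
    ‖w * Complex.exp (-(κ * u))‖ ≤ 1 - a / 2 := by
  rw [norm_mul, norm_exp_neg_mul]
  have h2 : ‖w‖ ≤ 1 := by simpa using (mem_ball_zero_iff.1 hw).le
  refine (mul_le_of_le_one_left (Real.exp_pos _).le h2).trans ?_
  refine (Real.exp_le_exp.2 (neg_le_neg hu)).trans ?_
  have h3 := Real.add_one_le_exp a
  rw [Real.exp_neg]
  refine (inv_anti₀ (by linarith) h3).trans ?_
  rw [inv_le_iff_one_le_mul₀ (by linarith)]
  nlinarith

/-- The exponential factor is at least `1 - (1 - |w|²) / 2 = (1 + |w|²) / 2 ≥ |w|`. -/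
theorem sq_le_norm_mul_exp {κ : ℝ} {u w : ℂ} (hw : w ∈ ball (0 : ℂ) 1)
    (hu : 2 * (κ * u.re) ≤ 1 - ‖w‖ ^ 2) : ‖w‖ ^ 2 ≤ ‖w * Complex.exp (-(κ * u))‖ := by
  rw [norm_mul, norm_exp_neg_mul, pow_two]
  have h2 : ‖w‖ < 1 := by simpa using hw
  refine mul_le_mul_of_nonneg_left ?_ (norm_nonneg _)
  have := Real.add_one_le_exp (-(κ * u.re))
  nlinarith [norm_nonneg w]

/-- A self-map of the disk that pushes points away from `1` to distance comparable to `δ`. -/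
noncomputable def pushMap (δ : ℝ) (w : ℂ) : ℂ :=
  w * Complex.exp (-(((1 / 8 : ℝ) : ℂ) * arcBump δ w))

theorem pushMap_analyticOnNhd (δ : ℝ) : AnalyticOnNhd ℂ (pushMap δ) (ball 0 1) := fun w hw => by
  have := arcBump_analyticOnNhd δ w hw
  unfold pushMap
  fun_prop

theorem pushMap_zero (δ : ℝ) : pushMap δ 0 = 0 := by simp [pushMap]

theorem norm_one_sub_le_two {w : ℂ} (hw : w ∈ ball (0 : ℂ) 1) : ‖1 - w‖ ≤ 2 := by
  have := norm_sub_le 1 w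
  rw [norm_one] at this
  linarith [mem_ball_zero_iff.1 hw]

theorem norm_one_add_le_two {w : ℂ} (hw : w ∈ ball (0 : ℂ) 1) : ‖1 + w‖ ≤ 2 := by
  have := norm_add_le 1 w
  rw [norm_one] at this
  linarith [mem_ball_zero_iff.1 hw]

theorem two_sub_le_norm_one_add (w : ℂ) : 2 - ‖1 - w‖ ≤ ‖1 + w‖ := by
  have := norm_add_le (1 - w) (1 + w)
  rw [show (1 - w) + (1 + w) = 2 by ring] at this
  norm_num at this
  linarith

theorem norm_sub_one_pos {w : ℂ} (hw : w ∈ ball (0 : ℂ) 1) : 0 < ‖w - 1‖ := by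
  rw [norm_pos_iff, sub_ne_zero]
  rintro rfl
  simp at hw

theorem one_sub_norm_le_norm_sub {z ξ : ℂ} (hξ : ‖ξ‖ = 1) : 1 - ‖z‖ ≤ ‖z - ξ‖ := by
  have := norm_sub_norm_le ξ z
  rwa [hξ, norm_sub_rev] at this

/-- Shrinking a point of the disk radially at most halves its distance to a point of the circle. -/
theorem norm_sub_le_two_mul_norm_mul_sub {z ξ : ℂ} (hξ : ‖ξ‖ = 1) (hz : z ∈ ball (0 : ℂ) 1) {t : ℝ}
    (ht : t ∈ Icc (0 : ℝ) 1) : ‖z - ξ‖ ≤ 2 * ‖(t : ℂ) * z - ξ‖ := by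
  have h1 : ‖z - ξ‖ ≤ ‖z - t * z‖ + ‖(t : ℂ) * z - ξ‖ := norm_sub_le_norm_sub_add_norm_sub _ _ _
  have h2 : ‖z - t * z‖ = (1 - t) * ‖z‖ := by
    rw [show z - t * z = ((1 - t : ℝ) : ℂ) * z by push_cast; ring, norm_mul, Complex.norm_real,
      Real.norm_of_nonneg (by linarith [ht.2])]
  have h3 := one_sub_norm_le_norm_sub (z := t * z) hξ
  rw [norm_mul, Complex.norm_real, Real.norm_of_nonneg ht.1] at h3
  have h4 : ‖z‖ < 1 := by simpa using hz
  nlinarith [norm_nonneg z, ht.1, ht.2]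

/-- Within `δ / 2` of `1` the bump has real part at least `δ / 2` and forces the image inside the
circle by `δ / 32`. Farther out the displacement `δ / 4` costs at most half the distance to `1`.
Beyond `4 δ` the decay of the bump keeps the map almost norm-preserving. -/
theorem pushMap_bounds {δ : ℝ} (hδ : 0 < δ) (hδ1 : δ ≤ 1) {w : ℂ} (hw : w ∈ ball (0 : ℂ) 1) :
    pushMap δ w ∈ ball (0 : ℂ) 1 ∧ ‖pushMap δ w - w‖ ≤ δ / 4 ∧
      ‖w - 1‖ / 32 ≤ ‖pushMap δ w - 1‖ ∧ δ / 32 ≤ ‖pushMap δ w - 1‖ ∧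
      (4 * δ ≤ ‖w - 1‖ → ‖w‖ ^ 2 ≤ ‖pushMap δ w‖) := by
  obtain ⟨h1, h2, -, h4, h5⟩ := arcBump_bounds hδ hw
  have hsub : ‖pushMap δ w - w‖ ≤ δ / 4 := by
    refine (norm_mul_exp_sub_le (by norm_num) hw (by linarith)).trans (by linarith)
  have hr : ‖w - 1‖ = ‖1 - w‖ := norm_sub_rev _ _
  have hlow : δ / 2 ≤ ‖w - 1‖ → ‖w - 1‖ / 2 ≤ ‖pushMap δ w - 1‖ := fun h => by
    have := norm_sub_le_norm_sub_add_norm_sub w (pushMap δ w) 1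
    linarith [norm_sub_rev w (pushMap δ w)]
  have hlow' : ‖w - 1‖ < δ / 2 → δ / 32 ≤ ‖pushMap δ w - 1‖ := fun h => by
    rw [hr] at h
    have h6 := two_sub_le_norm_one_add w
    have h7 := h5 (by nlinarith)
    have h8 := norm_mul_exp_le_one_sub (κ := 1 / 8) (a := δ / 16) (u := arcBump δ w) hw
      (by positivity) (by linarith) (by linarith)
    have h9 := one_sub_norm_le_norm_sub (z := pushMap δ w) (ξ := 1) (by simp)
    have h10 : ‖pushMap δ w‖ ≤ 1 - δ / 16 / 2 := h8
    linarith
  refine ⟨?_, hsub, ?_, ?_, fun h => ?_⟩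
  · rw [mem_ball_zero_iff]
    exact (norm_mul_exp_le (by norm_num) h1).trans_lt (by simpa using hw)
  · rcases le_or_gt (δ / 2) ‖w - 1‖ with h | h
    · linarith [hlow h, norm_nonneg (w - 1)]
    · linarith [hlow' h]
  · rcases le_or_gt (δ / 2) ‖w - 1‖ with h | h
    · linarith [hlow h]
    · exact hlow' h
  · rw [hr] at h
    have h6 := norm_one_add_le_two hw
    have h7 := h4 (by nlinarith)
    refine sq_le_norm_mul_exp hw ?_
    have h8 : (4 * δ) ^ 2 ≤ ‖1 - w‖ ^ 2 := pow_le_pow_left₀ (by positivity) h 2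
    have h9 : (arcBump δ w).re * (4 * δ) ^ 2 ≤ 3 * δ ^ 2 * (1 - ‖w‖ ^ 2) :=
      (mul_le_mul_of_nonneg_left h8 h1).trans h7
    have h10 : δ ^ 2 * (16 * (arcBump δ w).re) ≤ δ ^ 2 * (3 * (1 - ‖w‖ ^ 2)) := by linarith
    have h11 := le_of_mul_le_mul_left h10 (by positivity)
    have h12 : ‖w‖ < 1 := by simpa using hw
    have : 0 ≤ 1 - ‖w‖ ^ 2 := by nlinarith [norm_nonneg w]
    linarith

theorem one_sub_le_of_sq_le {x y : ℝ} (h : x ^ 2 ≤ y) : 1 - y ≤ 2 * (1 - x) := by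
  nlinarith [sq_nonneg (1 - x)]

/-- Points of the segment `[0, z]` stay at distance `8 δ` from `1`, so their preimages, displaced by
at most `δ / 4`, lie in the region where `|w|² ≤ |pushMap δ w|`. -/
theorem pushMap_covers {δ : ℝ} (hδ : 0 < δ) (hδ1 : δ ≤ 1) {z : ℂ} (hz : z ∈ ball (0 : ℂ) 1)
    (h : 16 * δ ≤ ‖z - 1‖) : ∃ w ∈ ball (0 : ℂ) 1, pushMap δ w = z ∧ ‖w‖ ^ 2 ≤ ‖z‖ := by
  refine exists_preimage_of_segment (pushMap_analyticOnNhd δ) (pushMap_zero δ) hz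
    fun t ht w hw he => ?_
  obtain ⟨-, h2, -, -, h5⟩ := pushMap_bounds hδ hδ1 hw
  rw [← he]
  refine h5 ?_
  have h6 := norm_sub_le_two_mul_norm_mul_sub (ξ := 1) (by simp) hz ht
  rw [← he] at h6
  have h7 := norm_sub_le_norm_sub_add_norm_sub (pushMap δ w) w 1
  linarith

/-! ### The theorem for one boundary point. -/

/-- Zeros at distance at least `16 δ` from a singular boundary point of the growth. -/
theorem zeroBound_off_singularity {f : ℂ → ℂ} {K q σ τ δ : ℝ}
    (hf : AnalyticOnNhd ℂ f (ball 0 1)) (h0 : ‖f 0‖ = 1) (hK : 0 ≤ K)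
    (hσ0 : 0 ≤ σ) (hσ1 : σ < 1) (hτ : 0 ≤ τ) (hq : q = σ + τ) (hδ : 0 < δ) (hδ1 : δ ≤ 1)
    (h : ∀ z ∈ ball (0 : ℂ) 1, ‖f z‖ ≤ Real.exp (K * ‖z - 1‖ ^ (-q))) :
    ZeroBound f (fun z => if 16 * δ ≤ ‖z - 1‖ then 1 - ‖z‖ else 0)
      (2 * (K * 32 ^ q * δ ^ (-τ) * circleConst σ)) := by
  have hψm : ∀ w ∈ ball (0 : ℂ) 1, pushMap δ w ∈ ball (0 : ℂ) 1 := fun w hw =>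
    (pushMap_bounds hδ hδ1 hw).1
  refine ZeroBound.of_comp (b := fun w => 2 * (1 - ‖w‖)) hf h0 (pushMap_analyticOnNhd δ) hψm
    (pushMap_zero δ) ?_ (ZeroBound.const_mul zero_le_two ?_)
  · intro z hz
    split_ifs with hc
    · right
      obtain ⟨w, hw, hwz, hwn⟩ := pushMap_covers hδ hδ1 hz hc
      exact ⟨w, hw, hwz, one_sub_le_of_sq_le hwn⟩
    · exact Or.inl le_rfl
  · refine zeroBound_of_integrable_growth
      (fun w hw => (hf _ (hψm w hw)).comp (pushMap_analyticOnNhd δ w hw))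
      (by simp [pushMap_zero, h0]) hσ0 hσ1 (by positivity) fun w hw => ?_
    refine (h _ (hψm w hw)).trans (Real.exp_le_exp.2 ?_)
    obtain ⟨-, -, h3, h4, -⟩ := pushMap_bounds hδ hδ1 hw
    have hw1 := norm_sub_one_pos hw
    -- The part `τ` of the exponent is spent on the uniform bound `δ / 32`, the part `σ < 1` on the
    -- comparison with `|w - 1|`.
    have e1 : ‖pushMap δ w - 1‖ ^ (-q)
        = ‖pushMap δ w - 1‖ ^ (-τ) * ‖pushMap δ w - 1‖ ^ (-σ) := by
      rw [← Real.rpow_add (norm_sub_one_pos (hψm w hw)), hq]; ring_nf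
    have e2 : (32 : ℝ) ^ q * δ ^ (-τ) * ‖w - 1‖ ^ (-σ)
        = (δ / 32) ^ (-τ) * (‖w - 1‖ / 32) ^ (-σ) := by
      rw [Real.div_rpow hδ.le (by norm_num), Real.div_rpow hw1.le (by norm_num), hq,
        Real.rpow_add (by norm_num), Real.rpow_neg (by norm_num : (0 : ℝ) ≤ 32),
        Real.rpow_neg (by norm_num : (0 : ℝ) ≤ 32)]
      field_simp
    rw [mul_assoc K, mul_assoc K, e1, e2]
    refine mul_le_mul_of_nonneg_left (mul_le_mul ?_ ?_ (by positivity) (by positivity)) hK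
    · exact Real.rpow_le_rpow_of_nonpos (by positivity) h4 (by linarith)
    · exact Real.rpow_le_rpow_of_nonpos (by positivity) h3 (by linarith)

/-- The theorem for a single boundary point. -/
theorem zeroBound_one_point {q s : ℝ} (hq : 0 ≤ q) (hs : 0 ≤ s) (hqs : q - 1 < s) :
    ∃ C : ℝ, 0 ≤ C ∧ ∀ (f : ℂ → ℂ) (K : ℝ), AnalyticOnNhd ℂ f (ball 0 1) → ‖f 0‖ = 1 → 0 ≤ K →
      (∀ z ∈ ball (0 : ℂ) 1, ‖f z‖ ≤ Real.exp (K * ‖z - 1‖ ^ (-q))) →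
      ZeroBound f (fun z => (1 - ‖z‖) * ‖z - 1‖ ^ s) (C * K) := by
  rcases hs.eq_or_lt with rfl | hs
  · refine ⟨2 * (32 ^ q * circleConst q), by have := circleConst_nonneg q; positivity,
      fun f K hf h0 hK h T hT => ?_⟩
    -- When `s = 0` one has `q < 1`, so `τ = 0` is allowed and the bound does not depend on `δ`; `δ`
    -- may be taken small enough for all of `T`.
    obtain ⟨δ, hδ, hδT⟩ : ∃ δ : ℝ, δ ∈ Ioc (0 : ℝ) 1 ∧ ∀ z ∈ T, 16 * δ ≤ ‖z - 1‖ := by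
      have : ∀ᶠ δ : ℝ in 𝓝[>] 0, ∀ z ∈ T, 16 * δ ≤ ‖z - 1‖ := by
        rw [Finset.eventually_all]
        intro z hz
        have hp := norm_sub_one_pos (hT z hz)
        refine mem_of_superset (Ioo_mem_nhdsGT (show 0 < ‖z - 1‖ / 16 by positivity)) ?_
        intro δ hδ
        simp only [mem_ofPred_eq]
        linarith [hδ.2]
      obtain ⟨δ, h1, h2⟩ := (this.and (Ioc_mem_nhdsGT zero_lt_one)).exists
      exact ⟨δ, h2, h1⟩
    have := zeroBound_off_singularity hf h0 hK hq (by linarith) le_rfl (add_zero q).symm hδ.1 hδ.2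
      h T hT
    refine le_trans (le_of_eq (Finset.sum_congr rfl fun z hz => ?_))
      (this.trans (le_of_eq ?_))
    · simp [hδT z hz]
    · simp; ring
  · have hm : max 0 (q - s) < 1 := max_lt one_pos (by linarith)
    -- The midpoint of `max 0 (q - s)` and `1` gives `σ < 1` and `q - σ < s`; the cap at `q` keeps
    -- `τ = q - σ` nonnegative.
    set σ := min q ((max 0 (q - s) + 1) / 2) with hσ
    have hσ0 : 0 ≤ σ := le_min hq (by have := le_max_left 0 (q - s); linarith)
    have hσ1 : σ < 1 := (min_le_right _ _).trans_lt (by linarith)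
    have hτ0 : 0 ≤ q - σ := sub_nonneg.2 (min_le_left _ _)
    have hτs : q - σ < s := by
      rcases min_choice q ((max 0 (q - s) + 1) / 2) with e | e
      · rw [hσ, e]; linarith
      · rw [hσ, e]; have := le_max_right 0 (q - s); linarith
    have hc := circleConst_nonneg σ
    have hx1 : (2 : ℝ) ^ (q - σ - s) < 1 :=
      Real.rpow_lt_one_of_one_lt_of_neg (by norm_num) (by linarith)
    have hx : 0 ≤ (1 - (2 : ℝ) ^ (q - σ - s))⁻¹ := inv_nonneg.2 (by linarith)
    refine ⟨4 ^ s * (1 - 2 ^ (q - σ - s))⁻¹ * (2 * (32 ^ q * 16 ^ (q - σ) * circleConst σ)),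
      by positivity, fun f K hf h0 hK h T hT => ?_⟩
    have := sum_rpow_le_of_dyadic T (fun z => (analyticOrderNatAt f z : ℝ) * (1 - ‖z‖))
      (fun z => ‖z - 1‖) (B := 2 * (32 ^ q * 16 ^ (q - σ) * circleConst σ) * K) (τ := q - σ) (s := s)
      (fun z hz => mul_nonneg (Nat.cast_nonneg _)
        (by have := mem_ball_zero_iff.1 (hT z hz); linarith))
      (fun z hz => norm_sub_one_pos (hT z hz))
      (fun z hz => by rw [norm_sub_rev]; exact norm_one_sub_le_two (hT z hz))
      hs.le hτs (by positivity) (fun n => ?_)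
    · refine le_trans (le_of_eq (Finset.sum_congr rfl fun z _ => ?_)) (this.trans (le_of_eq ?_))
      · simp only; ring
      · ring
    · have hδ : (0 : ℝ) < 2⁻¹ ^ n / 16 := by positivity
      have hδ1 : (2 : ℝ)⁻¹ ^ n / 16 ≤ 1 := by
        have : (2 : ℝ)⁻¹ ^ n ≤ 1 := pow_le_one₀ (by norm_num) (by norm_num)
        linarith
      have := zeroBound_off_singularity hf h0 hK hσ0 hσ1 hτ0 (by ring) hδ hδ1 h T hT
      rw [Finset.sum_filter]
      refine le_trans (le_of_eq (Finset.sum_congr rfl fun z _ => ?_)) (this.trans (le_of_eq ?_))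
      · have e : 16 * ((2 : ℝ)⁻¹ ^ n / 16) = 2⁻¹ ^ n := by ring
        simp only [e, mul_ite, mul_zero]
      · have e : ((2 : ℝ)⁻¹ ^ n / 16) ^ (-(q - σ)) = 16 ^ (q - σ) * (2 ^ (q - σ)) ^ n := by
          rw [Real.div_rpow (by positivity) (by norm_num), Real.rpow_neg (by norm_num : (0:ℝ) ≤ 16),
            inv_pow, ← Real.inv_rpow (by norm_num), Real.rpow_neg (by positivity),
            Real.inv_rpow (by norm_num), Real.inv_rpow (by positivity),
            ← Real.rpow_natCast, ← Real.rpow_natCast, ← Real.rpow_mul (by norm_num),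
            ← Real.rpow_mul (by norm_num), mul_comm (n : ℝ)]
          simp
          ring
        rw [e]; ring

/-! ### Isolating one boundary arc. -/

/-- A self-map of the disk whose image touches the circle only on an arc about `1`. -/
noncomputable def arcMap (L κ : ℝ) (w : ℂ) : ℂ := w * Complex.exp (-((κ : ℂ) * arcBump L (-w)))

theorem arcMap_analyticOnNhd (L κ : ℝ) : AnalyticOnNhd ℂ (arcMap L κ) (ball 0 1) := fun w hw => by
  have h1 : AnalyticAt ℂ (arcBump L) (-w) := arcBump_analyticOnNhd L (-w) (by simpa using hw)
  have h2 : AnalyticAt ℂ (fun w => arcBump L (-w)) w :=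
    h1.comp_of_eq (f := fun w => -w) (by fun_prop) rfl
  unfold arcMap
  fun_prop

/-- The bump is centred at `-1` with large `L`, so it is active on all of the circle except an arc
of size about `d` at `1`. Points with `|w - 1| ≥ d / 2` are thus pushed inside, while near `1` the
displacement is at most `|w - 1| / 8`. -/
theorem arcMap_bounds {d : ℝ} (hd : 0 < d) (hd1 : d ≤ 1) {w : ℂ} (hw : w ∈ ball (0 : ℂ) 1) :
    let P := arcMap (12 / d) (d ^ 2 / 2304) w
    P ∈ ball (0 : ℂ) 1 ∧ (d / 768 ≤ 1 - ‖P‖ ∨ ‖P - 1‖ ≤ 3 / 4 * d) ∧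
      d / 1536 * ‖w - 1‖ ≤ ‖P - 1‖ ∧ ‖P - 1‖ ≤ 2 * ‖w - 1‖ ∧
      (∀ z : ℂ, z ∈ ball (0 : ℂ) 1 → ‖z - 1‖ < d / 48 → ∀ t ∈ Icc (0 : ℝ) 1, P = t * z →
        ‖w‖ ^ 2 ≤ ‖P‖) := by
  intro P
  have hL : 0 < 12 / d := by positivity
  have hmw : -w ∈ ball (0 : ℂ) 1 := by simpa using hw
  obtain ⟨h1, h2, h3, h4, h5⟩ := arcBump_bounds hL hmw
  rw [sub_neg_eq_add, ← sub_eq_add_neg] at h3 h4 h5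
  rw [norm_neg] at h4
  set κ := d ^ 2 / 2304 with hκ
  have hκ0 : 0 ≤ κ := by positivity
  -- `L = 12 / d` places the points with `|w - 1| ≥ d / 2` where the bump exceeds `L / 2`; `κ` is
  -- chosen to make `κ L²` an absolute constant.
  have hκL : κ * (12 / d) = d / 192 := by rw [hκ]; field_simp; norm_num
  have hκL2 : κ * (12 / d) ^ 2 = 1 / 16 := by rw [hκ]; field_simp; norm_num
  set G := arcBump (12 / d) (-w) with hG
  have hκG : κ * ‖G‖ ≤ d / 192 := by
    rw [← hκL]; exact mul_le_mul_of_nonneg_left h2 hκ0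
  have hPw : ‖P - w‖ ≤ 2 * (κ * ‖G‖) := norm_mul_exp_sub_le hκ0 hw (by linarith)
  have hr : ‖w - 1‖ = ‖1 - w‖ := norm_sub_rev _ _
  have hw1 : ‖w‖ < 1 := by simpa using hw
  have hPle : ‖P‖ ≤ ‖w‖ := norm_mul_exp_le hκ0 h1
  have h1P := one_sub_norm_le_norm_sub (z := P) (ξ := 1) (by simp)
  have hsum := two_sub_le_norm_one_add w
  have hle2 := norm_one_sub_le_two hw
  have hadd2 := norm_one_add_le_two hw
  have hPw1 : ‖P - 1‖ ≤ ‖P - w‖ + ‖w - 1‖ := norm_sub_le_norm_sub_add_norm_sub _ _ _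
  have hwP1 : ‖w - 1‖ ≤ ‖P - w‖ + ‖P - 1‖ := by
    rw [norm_sub_rev P w]; exact norm_sub_le_norm_sub_add_norm_sub _ _ _
  have hfar : d / 2 ≤ ‖w - 1‖ → ‖P‖ ≤ 1 - d / 384 / 2 := fun h => by
    have h6 : (12 / d) * (d / 2) ≤ (12 / d) * ‖1 - w‖ :=
      mul_le_mul_of_nonneg_left (by rwa [hr] at h) hL.le
    rw [show (12 / d) * (d / 2) = 6 by field_simp; norm_num] at h6
    have h7 := mul_le_mul_of_nonneg_left (h5 (by linarith)) hκ0
    have h8 : d / 384 ≤ κ * G.re := by linarith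
    exact norm_mul_exp_le_one_sub hw (by positivity) (by linarith) h8
  have hnear : ‖w - 1‖ ≤ 1 → ‖P - w‖ ≤ ‖w - 1‖ / 8 := fun h => by
    have h6 : ‖G‖ ≤ ‖G‖ * ‖1 + w‖ := le_mul_of_one_le_right (norm_nonneg _) (by linarith)
    have h7 := mul_le_mul_of_nonneg_left (h6.trans h3) hκ0
    rw [← mul_assoc, hκL2] at h7
    linarith
  refine ⟨?_, ?_, ?_, ?_, ?_⟩
  · rw [mem_ball_zero_iff]; linarith
  · rcases le_or_gt (d / 2) ‖w - 1‖ with h | h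
    · left; linarith [hfar h]
    · right; linarith
  · rcases le_or_gt (d / 2) ‖w - 1‖ with h | h
    · have := hfar h
      have := mul_le_mul_of_nonneg_left hle2 hd.le
      rw [hr]
      linarith
    · have := hnear (by linarith)
      have := mul_le_of_le_one_left (norm_nonneg (w - 1)) hd1
      linarith [norm_nonneg (w - 1)]
  · rcases le_or_gt 1 ‖w - 1‖ with h | h
    · have : ‖P - 1‖ ≤ ‖P‖ + 1 := by simpa using norm_sub_le P 1
      linarith
    · linarith [hnear h.le, norm_nonneg (w - 1)]
  · intro z hz hzd t ht he
    have hz1 : ‖z‖ < 1 := by simpa using hz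
    have hPlow : ‖w‖ * (1 - d / 192) ≤ ‖P‖ := by
      have e : ‖P‖ = ‖w‖ * Real.exp (-(κ * G.re)) := by
        rw [← norm_exp_neg_mul, ← norm_mul]; rfl
      rw [e]
      refine mul_le_mul_of_nonneg_left ?_ (norm_nonneg _)
      have h6 := Real.add_one_le_exp (-(κ * G.re))
      have h7 := mul_le_mul_of_nonneg_left (Complex.re_le_norm G) hκ0
      linarith
    -- If `w` is away from the circle, the crude loss factor `1 - d / 192` is already at least
    -- `|w|`. Otherwise `P` is close to the circle, hence to `z` on its segment, hence `w` is within
    -- `d / 24` of `1`, where the bump decays.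
    rcases le_or_gt ‖w‖ (1 - d / 192) with hsmall | hbig
    · calc ‖w‖ ^ 2 = ‖w‖ * ‖w‖ := pow_two _
        _ ≤ ‖w‖ * (1 - d / 192) := mul_le_mul_of_nonneg_left hsmall (norm_nonneg _)
        _ ≤ ‖P‖ := hPlow
    · have hP1 : 1 - d / 96 ≤ ‖P‖ := by
        have h6 := mul_le_mul_of_nonneg_right hbig.le (by linarith : 0 ≤ 1 - d / 192)
        linarith [mul_self_nonneg d]
      have hPt : ‖P‖ = t * ‖z‖ := by
        rw [he, norm_mul, Complex.norm_real, Real.norm_of_nonneg ht.1]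
      have ht1 : 1 - d / 96 ≤ t := by linarith [mul_le_of_le_one_right ht.1 hz1.le]
      have hPz : ‖P - 1‖ ≤ (1 - t) + d / 48 := by
        have h6 := norm_sub_le_norm_sub_add_norm_sub P z 1
        have h7 : ‖P - z‖ = (1 - t) * ‖z‖ := by
          rw [norm_sub_rev, he, show z - t * z = ((1 - t : ℝ) : ℂ) * z by push_cast; ring,
            norm_mul, Complex.norm_real, Real.norm_of_nonneg (by linarith [ht.2])]
        have h8 : (1 - t) * ‖z‖ ≤ 1 - t :=
          mul_le_of_le_one_right (by linarith [ht.2]) hz1.le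
        linarith
      have hwd : ‖1 - w‖ ≤ d / 24 := by linarith
      have h6 : 2 * (12 / d) * ‖1 - w‖ ≤ 1 := by
        calc 2 * (12 / d) * ‖1 - w‖ ≤ 2 * (12 / d) * (d / 24) :=
              mul_le_mul_of_nonneg_left hwd (by positivity)
          _ = 1 := by field_simp; norm_num
      have h7 := h4 (by linarith)
      have h8 : (1 : ℝ) ≤ ‖1 + w‖ ^ 2 := one_le_pow₀ (by linarith)
      have h9 := mul_le_mul_of_nonneg_left ((le_mul_of_one_le_right h1 h8).trans h7) hκ0
      have h10 : κ * (3 * (12 / d) ^ 2 * (1 - ‖w‖ ^ 2)) = 3 / 16 * (1 - ‖w‖ ^ 2) := by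
        rw [← mul_assoc, mul_left_comm, hκL2]; ring
      have : 0 ≤ 1 - ‖w‖ ^ 2 := by nlinarith [norm_nonneg w]
      have h11 : 2 * (κ * G.re) ≤ 1 - ‖w‖ ^ 2 := by linarith
      exact sq_le_norm_mul_exp hw h11

/-! ### Several boundary points: local bounds and compactness. -/

/-- A uniform bound for the part of the weighted zero sum that lies in `U`. -/
def LocalZeroBound {N : ℕ} (ε : ℝ) (ζ : Fin N → ℂ) (q : Fin N → ℝ) (U : Set ℂ) : Prop :=
  ∃ C : ℝ, 0 ≤ C ∧ ∀ (f : ℂ → ℂ) (K : ℝ), AnalyticOnNhd ℂ f (ball 0 1) → ‖f 0‖ = 1 → 0 ≤ K →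
    (∀ z ∈ ball (0 : ℂ) 1, ‖f z‖ ≤ Real.exp (K * growthBoundary ζ q z)) →
    ZeroBound f (U.indicator (zeroWeight 1 ε ζ q)) (C * K)

section

variable {N : ℕ} {ε : ℝ} {ζ : Fin N → ℂ} {q : Fin N → ℝ}

theorem zeroWeight_nonneg {s : ℝ} {z : ℂ} (hz : z ∈ ball (0 : ℂ) 1) : 0 ≤ zeroWeight s ε ζ q z := by
  have : 0 ≤ 1 - ‖z‖ := by have := mem_ball_zero_iff.1 hz; linarith
  unfold zeroWeight
  have := Finset.prod_nonneg (s := Finset.univ)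
    (f := fun j => ‖z - ζ j‖ ^ max (q j - 1 + ε) 0) fun j _ => by positivity
  positivity

theorem LocalZeroBound.mono {U V : Set ℂ} (hUV : U ⊆ V) (h : LocalZeroBound ε ζ q V) :
    LocalZeroBound ε ζ q U := by
  obtain ⟨C, hC, h⟩ := h
  refine ⟨C, hC, fun f K hf h0 hK hg => (h f K hf h0 hK hg).mono le_rfl fun z hz => ?_⟩
  by_cases hU : z ∈ U
  · rw [indicator_of_mem hU, indicator_of_mem (hUV hU)]
  · rw [indicator_of_notMem hU]
    exact indicator_apply_nonneg fun _ => zeroWeight_nonneg hz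

theorem LocalZeroBound.union {U V : Set ℂ} (hU : LocalZeroBound ε ζ q U)
    (hV : LocalZeroBound ε ζ q V) : LocalZeroBound ε ζ q (U ∪ V) := by
  obtain ⟨C, hC, hU⟩ := hU
  obtain ⟨D, hD, hV⟩ := hV
  refine ⟨C + D, by positivity, fun f K hf h0 hK hg =>
    ((hU f K hf h0 hK hg).add (hV f K hf h0 hK hg)).mono (by rw [add_mul]) fun z hz => ?_⟩
  have h1 := zeroWeight_nonneg (ε := ε) (ζ := ζ) (q := q) (s := 1) hz
  by_cases hzU : z ∈ U <;> by_cases hzV : z ∈ V <;> simp [indicator, hzU, hzV, h1]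

theorem localZeroBound_empty : LocalZeroBound ε ζ q ∅ :=
  ⟨0, le_rfl, fun f K _ _ _ _ T _ => by simp⟩

/-- Interface between geometry and the one-point theorem: it is applied to `f ∘ Ψ`, whose only
possible singularity is at `1`. -/
theorem localZeroBound_of_map {Ψ : ℂ → ℂ} {Q S A B : ℝ} {U : Set ℂ} (hQ : 0 ≤ Q) (hS : 0 ≤ S)
    (hQS : Q - 1 < S) (hA : 0 ≤ A) (hB : 0 ≤ B) (hΨ : AnalyticOnNhd ℂ Ψ (ball 0 1))
    (hΨm : ∀ w ∈ ball (0 : ℂ) 1, Ψ w ∈ ball (0 : ℂ) 1) (hΨ0 : Ψ 0 = 0)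
    (hgrowth : ∀ w ∈ ball (0 : ℂ) 1, growthBoundary ζ q (Ψ w) ≤ A * ‖w - 1‖ ^ (-Q))
    (hcover : ∀ z ∈ ball (0 : ℂ) 1, z ∈ U → ∃ w ∈ ball (0 : ℂ) 1, Ψ w = z ∧
      zeroWeight 1 ε ζ q z ≤ B * ((1 - ‖w‖) * ‖w - 1‖ ^ S)) :
    LocalZeroBound ε ζ q U := by
  obtain ⟨C, hC, h⟩ := zeroBound_one_point hQ hS hQS
  refine ⟨B * (C * A), by positivity, fun f K hf h0 hK hg => ?_⟩
  refine ZeroBound.of_comp (b := fun w => B * ((1 - ‖w‖) * ‖w - 1‖ ^ S)) hf h0 hΨ hΨm hΨ0 ?_ ?_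
  · intro z hz
    by_cases hzU : z ∈ U
    · right; rw [indicator_of_mem hzU]; exact hcover z hz hzU
    · left; rw [indicator_of_notMem hzU]
  · refine ZeroBound.mono (ZeroBound.const_mul hB (h (f ∘ Ψ) (K * A)
      (fun w hw => (hf _ (hΨm w hw)).comp (hΨ w hw)) (by simp [hΨ0, h0]) (by positivity)
      fun w hw => ?_)) (le_of_eq (by ring)) fun _ _ => le_rfl
    refine (hg _ (hΨm w hw)).trans (Real.exp_le_exp.2 ?_)
    rw [mul_assoc]
    exact mul_le_mul_of_nonneg_left (hgrowth w hw) hK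

theorem norm_sub_le_two {z ξ : ℂ} (hz : z ∈ ball (0 : ℂ) 1) (hξ : ‖ξ‖ = 1) : ‖z - ξ‖ ≤ 2 := by
  have := norm_sub_le z ξ
  linarith [mem_ball_zero_iff.1 hz]

/-- A dilation by some `ρ < 1` covers the ball and stays away from the circle, so the majorant
becomes bounded and the case `Q = S = 0` applies. -/
theorem localZeroBound_interior (hζ : ∀ j, ‖ζ j‖ = 1) (hq : ∀ j, 0 ≤ q j) {ξ : ℂ} (hξ : ‖ξ‖ < 1) :
    ∃ r > 0, LocalZeroBound ε ζ q (ball ξ r) := by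
  set r := (1 - ‖ξ‖) / 4 with hr
  have hr0 : 0 < r := by rw [hr]; linarith
  set ρ := ‖ξ‖ + 2 * r with hρ
  have hρ0 : 0 < ρ := by have := norm_nonneg ξ; linarith
  have hρ1 : 0 < 1 - ρ := by linarith
  have hnρ : ∀ w : ℂ, ‖(ρ : ℂ) * w‖ = ρ * ‖w‖ := fun w => by
    rw [norm_mul, Complex.norm_real, Real.norm_of_nonneg hρ0.le]
  have hm : ∀ w ∈ ball (0 : ℂ) 1, (ρ : ℂ) * w ∈ ball (0 : ℂ) 1 := fun w hw => by
    rw [mem_ball_zero_iff, hnρ]; have := mem_ball_zero_iff.1 hw; nlinarith [norm_nonneg w]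
  refine ⟨r, hr0, localZeroBound_of_map (Ψ := fun w => (ρ : ℂ) * w) (Q := 0) (S := 0)
    (A := (∏ j, (1 - ρ) ^ q j)⁻¹) (B := ρ / r * ∏ j, (2 : ℝ) ^ max (q j - 1 + ε) 0) le_rfl le_rfl
    (by norm_num) ?_ ?_ (fun w _ => by fun_prop) hm (by simp) ?_ ?_⟩
  · exact inv_nonneg.2 (Finset.prod_nonneg fun j _ => by positivity)
  · exact mul_nonneg (by positivity) (Finset.prod_nonneg fun j _ => by positivity)
  · intro w hw
    simp only [neg_zero, Real.rpow_zero, mul_one, growthBoundary]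
    refine inv_anti₀ (Finset.prod_pos fun j _ => by positivity)
      (Finset.prod_le_prod (fun j _ => by positivity) fun j _ => ?_)
    refine Real.rpow_le_rpow hρ1.le ?_ (hq j)
    refine le_trans ?_ (one_sub_norm_le_norm_sub (hζ j))
    rw [hnρ]
    have := mem_ball_zero_iff.1 hw
    nlinarith
  · intro z hz hzU
    have hzn : ‖z‖ ≤ ‖ξ‖ + r := by
      have h1 : ‖z - ξ‖ < r := by simpa [dist_eq_norm] using hzU
      have := norm_le_norm_add_norm_sub ξ z
      rw [norm_sub_rev] at this
      linarith
    have hwn : ‖z / ρ‖ = ‖z‖ / ρ := by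
      rw [norm_div, Complex.norm_real, Real.norm_of_nonneg hρ0.le]
    refine ⟨z / ρ, ?_, ?_, ?_⟩
    · rw [mem_ball_zero_iff, hwn, div_lt_one hρ0]; linarith
    · exact mul_div_cancel₀ z (by exact_mod_cast hρ0.ne')
    · rw [Real.rpow_zero, mul_one, zeroWeight, Real.rpow_one, hwn]
      have hp : ∏ j, ‖z - ζ j‖ ^ max (q j - 1 + ε) 0 ≤ ∏ j, (2 : ℝ) ^ max (q j - 1 + ε) 0 :=
        Finset.prod_le_prod (fun j _ => by positivity) fun j _ =>
          Real.rpow_le_rpow (norm_nonneg _) (norm_sub_le_two hz (hζ j)) (le_max_right _ _)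
      have hp0 : 0 ≤ ∏ j, (2 : ℝ) ^ max (q j - 1 + ε) 0 :=
        Finset.prod_nonneg fun j _ => by positivity
      have h1 : 1 ≤ ρ / r * (1 - ‖z‖ / ρ) := by
        rw [show ρ / r * (1 - ‖z‖ / ρ) = (ρ - ‖z‖) / r by field_simp, one_le_div hr0]
        linarith
      calc (1 - ‖z‖) * ∏ j, ‖z - ζ j‖ ^ max (q j - 1 + ε) 0
          ≤ 1 * ∏ j, (2 : ℝ) ^ max (q j - 1 + ε) 0 :=
            mul_le_mul (by linarith [norm_nonneg z]) hp
              (Finset.prod_nonneg fun j _ => by positivity) zero_le_one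
        _ ≤ (ρ / r * (1 - ‖z‖ / ρ)) * ∏ j, (2 : ℝ) ^ max (q j - 1 + ε) 0 :=
            mul_le_mul_of_nonneg_right h1 hp0
        _ = _ := by ring

theorem exists_separation (ζ : Fin N → ℂ) (ξ : ℂ) :
    ∃ d : ℝ, 0 < d ∧ d ≤ 1 ∧ ∀ j, ζ j ≠ ξ → d ≤ ‖ζ j - ξ‖ := by
  have h : ∀ᶠ d : ℝ in 𝓝[>] 0, ∀ j, ζ j ≠ ξ → d ≤ ‖ζ j - ξ‖ := by
    rw [eventually_all]
    intro j
    by_cases hj : ζ j = ξ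
    · exact Eventually.of_forall fun d h => absurd hj h
    · have := norm_pos_iff.2 (sub_ne_zero.2 hj)
      exact mem_of_superset (Ioo_mem_nhdsGT this) fun d hd _ => hd.2.le
  obtain ⟨d, h1, h2⟩ := (h.and (Ioc_mem_nhdsGT zero_lt_one)).exists
  exact ⟨d, h2.1, h2.2, h1⟩

/-- A rotated `arcMap` covers the points near `ξ` and stays away from every `ζ j ≠ ξ`. The exponents
written as sums over `ζ j = ξ` treat singular and regular `ξ` together. -/
theorem localZeroBound_boundary (hζ : ∀ j, ‖ζ j‖ = 1) (hinj : Function.Injective ζ)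
    (hq : ∀ j, 0 ≤ q j) (hε : 0 < ε) {ξ : ℂ} (hξ : ‖ξ‖ = 1) :
    ∃ r > 0, LocalZeroBound ε ζ q (ball ξ r) := by
  classical
  obtain ⟨d, hd, hd1, hsep⟩ := exists_separation ζ ξ
  set φ := arcMap (12 / d) (d ^ 2 / 2304) with hφ
  have hφ0 : φ 0 = 0 := by simp [hφ, arcMap]
  have hξ0 : ξ ≠ 0 := by rw [← norm_ne_zero_iff, hξ]; exact one_ne_zero
  have hnξ : ∀ u : ℂ, ‖ξ * u‖ = ‖u‖ := fun u => by rw [norm_mul, hξ, one_mul]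
  have hξ1 : ∀ u : ℂ, ‖ξ * u - ξ‖ = ‖u - 1‖ := fun u => by
    rw [show ξ * u - ξ = ξ * (u - 1) by ring, hnξ]
  have hite : ∀ (g : Fin N → ℝ) {x : ℝ}, 0 < x →
      x ^ (∑ j, if ζ j = ξ then g j else 0) = ∏ j, if ζ j = ξ then x ^ g j else 1 := by
    intro g x hx
    rw [Real.rpow_sum_of_pos hx]
    refine Finset.prod_congr rfl fun j _ => ?_
    split_ifs <;> simp
  -- By injectivity at most one index contributes; if none does, the claim is `-1 < 0`.
  have hQS : (∑ j, if ζ j = ξ then q j else 0) - 1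
      < ∑ j, if ζ j = ξ then max (q j - 1 + ε) 0 else 0 := by
    by_cases hex : ∃ j, ζ j = ξ
    · obtain ⟨j, hj⟩ := hex
      have hiff : ∀ i, ζ i = ξ ↔ i = j := fun i =>
        ⟨fun h => hinj (h.trans hj.symm), fun h => h ▸ hj⟩
      simp only [hiff, Finset.sum_ite_eq', Finset.mem_univ, if_true]
      linarith [le_max_left (q j - 1 + ε) 0]
    · push Not at hex
      simp [hex]
  refine ⟨d / 48, by positivity, localZeroBound_of_map (Ψ := fun w => ξ * φ w)
    (Q := ∑ j, if ζ j = ξ then q j else 0)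
    (S := ∑ j, if ζ j = ξ then max (q j - 1 + ε) 0 else 0)
    (A := (∏ j, (d / 1536) ^ q j)⁻¹) (B := 2 * ∏ j, (2 : ℝ) ^ max (q j - 1 + ε) 0)
    (Finset.sum_nonneg fun j _ => ?_) (Finset.sum_nonneg fun j _ => ?_) hQS ?_ ?_
    (fun w hw => analyticAt_const.mul (arcMap_analyticOnNhd _ _ w hw)) (fun w hw => ?_)
    (by simp [hφ0]) (fun w hw => ?_) (fun z hz hzU => ?_)⟩
  · split_ifs
    exacts [hq j, le_rfl]
  · split_ifs
    exacts [le_max_right _ _, le_rfl]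
  · exact inv_nonneg.2 (Finset.prod_nonneg fun j _ => by positivity)
  · exact mul_nonneg (by norm_num) (Finset.prod_nonneg fun j _ => by positivity)
  · rw [mem_ball_zero_iff, hnξ]
    exact mem_ball_zero_iff.1 (arcMap_bounds hd hd1 hw).1
  · obtain ⟨-, h2, h3, -, -⟩ := arcMap_bounds hd hd1 hw
    have hwp := norm_sub_one_pos hw
    rw [Real.rpow_neg hwp.le, hite q hwp, ← mul_inv, ← Finset.prod_mul_distrib, growthBoundary]
    refine inv_anti₀ (Finset.prod_pos fun j _ => ?_)
      (Finset.prod_le_prod (fun j _ => ?_) fun j _ => ?_)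
    · split_ifs <;> positivity
    · split_ifs <;> positivity
    · split_ifs with hj
      · rw [← Real.mul_rpow (by positivity) (by positivity), hj, hξ1]
        exact Real.rpow_le_rpow (by positivity) h3 (hq j)
      · rw [mul_one]
        refine Real.rpow_le_rpow (by positivity) ?_ (hq j)
        -- Either the image point is well inside the circle, or it is within `3 d / 4` of `ξ` and so
        -- at least `d / 4` from `ζ j`.
        rcases h2 with h2 | h2
        · refine le_trans ?_ (one_sub_norm_le_norm_sub (hζ j))
          rw [hnξ]
          exact le_trans (by linarith) h2
        · have h4 := norm_sub_le_norm_sub_add_norm_sub (ζ j) (ξ * φ w) ξ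
          rw [hξ1] at h4
          have h5 := hsep j hj
          have h6 : ‖φ w - 1‖ ≤ 3 / 4 * d := h2
          linarith [norm_sub_rev (ζ j) (ξ * φ w)]
  · have hzξ : ‖z / ξ - 1‖ < d / 48 := by
      have h1 : ‖z - ξ‖ < d / 48 := by simpa [dist_eq_norm] using hzU
      rwa [← hξ1, mul_div_cancel₀ z hξ0]
    have hzb : z / ξ ∈ ball (0 : ℂ) 1 := by
      rw [mem_ball_zero_iff, norm_div, hξ, div_one]; exact mem_ball_zero_iff.1 hz
    obtain ⟨w, hw, hwz, hwn⟩ := exists_preimage_of_segment (arcMap_analyticOnNhd _ _) hφ0 hzb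
      (fun t ht w hw he => by
        have := (arcMap_bounds hd hd1 hw).2.2.2.2 _ hzb hzξ t ht he
        rwa [he] at this)
    rw [norm_div, hξ, div_one] at hwn
    have hwz' : ξ * φ w = z := by
      rw [show φ w = z / ξ from hwz, mul_div_cancel₀ z hξ0]
    refine ⟨w, hw, hwz', ?_⟩
    have hwp := norm_sub_one_pos hw
    have h4 : ‖φ w - 1‖ ≤ 2 * ‖w - 1‖ := (arcMap_bounds hd hd1 hw).2.2.2.1
    rw [hite _ hwp, zeroWeight, Real.rpow_one]
    have hw1 : 0 ≤ 1 - ‖w‖ := by have := mem_ball_zero_iff.1 hw; linarith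
    calc (1 - ‖z‖) * ∏ j, ‖z - ζ j‖ ^ max (q j - 1 + ε) 0
        ≤ (2 * (1 - ‖w‖)) * ∏ j, ((2 : ℝ) ^ max (q j - 1 + ε) 0 *
            if ζ j = ξ then ‖w - 1‖ ^ max (q j - 1 + ε) 0 else 1) := by
          refine mul_le_mul (one_sub_le_of_sq_le hwn)
            (Finset.prod_le_prod (fun j _ => by positivity) fun j _ => ?_)
            (Finset.prod_nonneg fun j _ => by positivity) (by positivity)
          split_ifs with hj
          · rw [← Real.mul_rpow (by norm_num) (by positivity), hj]
            refine Real.rpow_le_rpow (by positivity) ?_ (le_max_right _ _)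
            rw [← hwz', hξ1]
            exact h4
          · rw [mul_one]
            exact Real.rpow_le_rpow (norm_nonneg _) (norm_sub_le_two hz (hζ j)) (le_max_right _ _)
      _ = _ := by rw [Finset.prod_mul_distrib]; ring

theorem growthBoundary_zero (hζ : ∀ j, ‖ζ j‖ = 1) : growthBoundary ζ q 0 = 1 := by
  simp [growthBoundary, hζ]

theorem growthRadial_zero {p : ℝ} (hζ : ∀ j, ‖ζ j‖ = 1) : growthRadial p ζ q 0 = 1 := by
  simp [growthRadial, hζ]

/-- The boundary growth case. -/
theorem zeroBound_growthBoundary (hζ : ∀ j, ‖ζ j‖ = 1) (hinj : Function.Injective ζ)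
    (hq : ∀ j, 0 ≤ q j) (hε : 0 < ε) :
    ∃ C : ℝ, 0 < C ∧ ∀ (f : ℂ → ℂ) (K : ℝ), AnalyticOnNhd ℂ f (ball 0 1) → ‖f 0‖ = 1 →
      (∀ z ∈ ball (0 : ℂ) 1, ‖f z‖ ≤ Real.exp (K * growthBoundary ζ q z)) →
      ZeroBound f (zeroWeight 1 ε ζ q) (C * K) := by
  have hloc : LocalZeroBound ε ζ q (closedBall 0 1) := by
    refine (isCompact_closedBall (0 : ℂ) 1).induction_on localZeroBound_empty
      (fun _ _ hst h => h.mono hst) (fun _ _ hs ht => hs.union ht) fun ξ hξ => ?_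
    obtain ⟨r, hr, h⟩ : ∃ r > 0, LocalZeroBound ε ζ q (ball ξ r) := by
      rcases (mem_closedBall_zero_iff.1 hξ).lt_or_eq with h | h
      · exact localZeroBound_interior hζ hq h
      · exact localZeroBound_boundary hζ hinj hq hε h
    exact ⟨_, mem_nhdsWithin_of_mem_nhds (ball_mem_nhds ξ hr), h⟩
  obtain ⟨C, hC, h⟩ := hloc
  refine ⟨C + 1, by positivity, fun f K hf h0 hg => ?_⟩
  -- Evaluation at `0`, where the majorant equals `1` and `|f 0| = 1`.
  have hK : 0 ≤ K := by
    have := hg 0 (by simp)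
    rwa [h0, growthBoundary_zero hζ, mul_one, Real.one_le_exp_iff] at this
  refine (h f K hf h0 hK hg).mono (by nlinarith) fun z hz => ?_
  rw [indicator_of_mem (ball_subset_closedBall hz)]

/-! ### Radial growth by dilation. -/

theorem growthRadial_mul_le (hζ : ∀ j, ‖ζ j‖ = 1) (hq : ∀ j, 0 ≤ q j) {p r : ℝ} (hp : 0 ≤ p)
    (hr : 0 ≤ r) (hr1 : r < 1) {u : ℂ} (hu : u ∈ ball (0 : ℂ) 1) :
    growthRadial p ζ q (r * u) ≤ (1 - r) ^ (-p) * (∏ j, (2 : ℝ) ^ q j) * growthBoundary ζ q u := by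
  have hu1 := mem_ball_zero_iff.1 hu
  have h1r : 0 < 1 - r := by linarith
  have hpos : ∀ j, 0 < ‖u - ζ j‖ := fun j =>
    lt_of_lt_of_le (by linarith) (one_sub_norm_le_norm_sub (hζ j))
  have e : (1 - r) ^ (-p) * (∏ j, (2 : ℝ) ^ q j) * growthBoundary ζ q u
      = ((1 - r) ^ p * ∏ j, (‖u - ζ j‖ / 2) ^ q j)⁻¹ := by
    have : ∏ j, (‖u - ζ j‖ / 2) ^ q j = (∏ j, ‖u - ζ j‖ ^ q j) / ∏ j, (2 : ℝ) ^ q j := by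
      rw [← Finset.prod_div_distrib]
      exact Finset.prod_congr rfl fun j _ => Real.div_rpow (norm_nonneg _) (by norm_num) _
    rw [this, Real.rpow_neg h1r.le, growthBoundary, mul_inv, inv_div]
    ring
  rw [e, growthRadial]
  have hprod : 0 < ∏ j, (‖u - ζ j‖ / 2) ^ q j :=
    Finset.prod_pos fun j _ => by have := hpos j; positivity
  refine inv_anti₀ (by positivity) (mul_le_mul ?_ (Finset.prod_le_prod
    (fun j _ => by positivity) fun j _ => ?_) hprod.le ?_)
  · refine Real.rpow_le_rpow h1r.le ?_ hp
    rw [norm_mul, Complex.norm_real, Real.norm_of_nonneg hr]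
    nlinarith
  · refine Real.rpow_le_rpow (by positivity) ?_ (hq j)
    have := norm_sub_le_two_mul_norm_mul_sub (hζ j) hu ⟨hr, hr1.le⟩
    linarith
  · refine Real.rpow_nonneg ?_ _
    rw [norm_mul, Complex.norm_real, Real.norm_of_nonneg hr]
    nlinarith

/-- Dividing by `r` moves `z` by at most `1 - r`, a quarter of its distance to the circle, so each
factor of the weight changes by a bounded ratio. -/
theorem zeroWeight_le_dilation (hζ : ∀ j, ‖ζ j‖ = 1) {r : ℝ} (hr : 0 < r) (hr1 : r < 1) {z : ℂ}
    (h : 4 * (1 - r) ≤ 1 - ‖z‖) :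
    zeroWeight 1 ε ζ q z
      ≤ (2 * ∏ j, (2 : ℝ) ^ max (q j - 1 + ε) 0) * zeroWeight 1 ε ζ q (z / r) := by
  have hwn : ‖z / r‖ = ‖z‖ / r := by
    rw [norm_div, Complex.norm_real, Real.norm_of_nonneg hr.le]
  have hzr : ‖z‖ / r ≤ 1 := by rw [div_le_one hr]; linarith
  have h1 : 1 - ‖z‖ ≤ 2 * (1 - ‖z‖ / r) := by
    rw [show 2 * (1 - ‖z‖ / r) = 2 * (r - ‖z‖) / r by field_simp, le_div_iff₀ hr]
    nlinarith [norm_nonneg z]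
  have h2 : ∀ j, ‖z - ζ j‖ ≤ 2 * ‖z / r - ζ j‖ := fun j => by
    have h3 := norm_sub_le_norm_sub_add_norm_sub z (z / r) (ζ j)
    have h4 : ‖z - z / r‖ = (1 - r) * (‖z‖ / r) := by
      have hrc : (r : ℂ) ≠ 0 := by exact_mod_cast hr.ne'
      rw [norm_sub_rev, show z / r - z = ((1 - r : ℝ) : ℂ) * (z / r) by push_cast; field_simp,
        norm_mul, Complex.norm_real, Real.norm_of_nonneg (by linarith), hwn]
    have h5 : (1 - r) * (‖z‖ / r) ≤ 1 - r := mul_le_of_le_one_right (by linarith) hzr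
    have h6 := one_sub_norm_le_norm_sub (z := z) (hζ j)
    linarith
  rw [zeroWeight, zeroWeight, Real.rpow_one, Real.rpow_one, hwn]
  calc (1 - ‖z‖) * ∏ j, ‖z - ζ j‖ ^ max (q j - 1 + ε) 0
      ≤ (2 * (1 - ‖z‖ / r)) * ∏ j, ((2 : ℝ) ^ max (q j - 1 + ε) 0 *
          ‖z / r - ζ j‖ ^ max (q j - 1 + ε) 0) := by
        refine mul_le_mul h1 (Finset.prod_le_prod (fun j _ => by positivity) fun j _ => ?_)
          (Finset.prod_nonneg fun j _ => by positivity) (by linarith)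
        rw [← Real.mul_rpow (by norm_num) (norm_nonneg _)]
        exact Real.rpow_le_rpow (norm_nonneg _) (h2 j) (le_max_right _ _)
    _ = _ := by rw [Finset.prod_mul_distrib]; ring

/-- The radial growth case, from the boundary growth case on the disks of radius `1 - 2⁻ⁿ / 4`. -/
theorem zeroBound_growthRadial (hζ : ∀ j, ‖ζ j‖ = 1) (hinj : Function.Injective ζ)
    (hq : ∀ j, 0 ≤ q j) (hε : 0 < ε) {p : ℝ} (hp : 0 ≤ p) :
    ∃ C : ℝ, 0 < C ∧ ∀ (f : ℂ → ℂ) (K : ℝ), AnalyticOnNhd ℂ f (ball 0 1) → ‖f 0‖ = 1 →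
      (∀ z ∈ ball (0 : ℂ) 1, ‖f z‖ ≤ Real.exp (K * growthRadial p ζ q z)) →
      ZeroBound f (zeroWeight (p + 1 + ε) ε ζ q) (C * K) := by
  obtain ⟨C, hC, h⟩ := zeroBound_growthBoundary hζ hinj hq hε
  set A := 2 * ∏ j, (2 : ℝ) ^ max (q j - 1 + ε) 0 with hA
  set D := ∏ j, (2 : ℝ) ^ q j with hD
  have hA0 : 0 < A := mul_pos two_pos (Finset.prod_pos fun j _ => by positivity)
  have hD0 : 0 < D := Finset.prod_pos fun j _ => by positivity
  have hx1 : (2 : ℝ) ^ (p - (p + ε)) < 1 :=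
    Real.rpow_lt_one_of_one_lt_of_neg (by norm_num) (by linarith)
  have hx : 0 < (1 - (2 : ℝ) ^ (p - (p + ε)))⁻¹ := inv_pos.2 (by linarith)
  refine ⟨4 ^ (p + ε) * (1 - 2 ^ (p - (p + ε)))⁻¹ * (A * C * 4 ^ p * D), by positivity,
    fun f K hf h0 hg T hT => ?_⟩
  have hK : 0 ≤ K := by
    have := hg 0 (by simp)
    rwa [h0, growthRadial_zero hζ, mul_one, Real.one_le_exp_iff] at this
  have hdy := sum_rpow_le_of_dyadic T
    (fun z => (analyticOrderNatAt f z : ℝ) * zeroWeight 1 ε ζ q z) (fun z => 1 - ‖z‖)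
    (B := A * C * 4 ^ p * D * K) (τ := p) (s := p + ε)
    (fun z hz => mul_nonneg (Nat.cast_nonneg _) (zeroWeight_nonneg (hT z hz)))
    (fun z hz => by have := mem_ball_zero_iff.1 (hT z hz); linarith)
    (fun z hz => by have := norm_nonneg z; linarith)
    (by linarith) (by linarith) (by positivity) (fun n => ?_)
  · refine le_trans (le_of_eq (Finset.sum_congr rfl fun z hz => ?_)) (hdy.trans (le_of_eq ?_))
    · have hz1 : 0 < 1 - ‖z‖ := by have := mem_ball_zero_iff.1 (hT z hz); linarith
      simp only [zeroWeight, Real.rpow_one]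
      rw [show p + 1 + ε = 1 + (p + ε) by ring, Real.rpow_add hz1, Real.rpow_one]
      ring
    · ring
  -- The choice `4 (1 - r) = 2⁻ⁿ` fits `zeroWeight_le_dilation` on the zeros with `1 - |z| ≥ 2⁻ⁿ`;
  -- the constant grows by `(1 - r)^(-p)`, which is the dyadic loss with `τ = p`.
  · set r : ℝ := 1 - 2⁻¹ ^ n / 4 with hr
    have h2n : (0 : ℝ) < 2⁻¹ ^ n := by positivity
    have h2n1 : (2 : ℝ)⁻¹ ^ n ≤ 1 := pow_le_one₀ (by norm_num) (by norm_num)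
    have hr0 : 0 < r := by linarith
    have hr1 : r < 1 := by linarith
    have hm : ∀ w ∈ ball (0 : ℂ) 1, (r : ℂ) * w ∈ ball (0 : ℂ) 1 := fun w hw => by
      rw [mem_ball_zero_iff, norm_mul, Complex.norm_real, Real.norm_of_nonneg hr0.le]
      have := mem_ball_zero_iff.1 hw
      nlinarith [norm_nonneg w]
    have hψ : AnalyticOnNhd ℂ (fun w : ℂ => (r : ℂ) * w) (ball 0 1) := fun w _ => by fun_prop
    have hcomp := h (f ∘ fun w : ℂ => (r : ℂ) * w) (K * ((1 - r) ^ (-p) * D))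
      (fun w hw => (hf _ (hm w hw)).comp (hψ w hw)) (by simp [h0]) (fun w hw => by
        refine (hg _ (hm w hw)).trans (Real.exp_le_exp.2 ?_)
        rw [mul_assoc]
        exact mul_le_mul_of_nonneg_left (growthRadial_mul_le hζ hq hp hr0.le hr1 hw) hK)
    have hfin := ZeroBound.of_comp
      (a := fun z => if (2 : ℝ)⁻¹ ^ n ≤ 1 - ‖z‖ then zeroWeight 1 ε ζ q z else 0)
      hf h0 hψ hm (by simp) (fun z hz => by
        split_ifs with hc
        · right
          refine ⟨z / r, ?_, mul_div_cancel₀ z (by exact_mod_cast hr0.ne'),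
            zeroWeight_le_dilation hζ hr0 hr1 (by linarith)⟩
          rw [mem_ball_zero_iff, norm_div, Complex.norm_real, Real.norm_of_nonneg hr0.le,
            div_lt_one hr0]
          linarith
        · exact Or.inl le_rfl) (hcomp.const_mul hA0.le) T hT
    rw [Finset.sum_filter]
    refine le_trans (le_of_eq (Finset.sum_congr rfl fun z _ => ?_)) (hfin.trans (le_of_eq ?_))
    · simp only [mul_ite, mul_zero]
    · have e : (1 - r) ^ (-p) = 4 ^ p * (2 ^ p) ^ n := by
        rw [hr, sub_sub_cancel, Real.div_rpow h2n.le (by norm_num),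
          Real.rpow_neg (by norm_num : (0 : ℝ) ≤ 4), inv_pow, Real.rpow_neg (by positivity),
          Real.inv_rpow (by positivity), inv_inv, div_inv_eq_mul, ← Real.rpow_natCast,
          ← Real.rpow_natCast, ← Real.rpow_mul (by norm_num), ← Real.rpow_mul (by norm_num),
          mul_comm (n : ℝ), mul_comm]
      rw [e]; ring

end

theorem theorem3 (N : ℕ) (ζ : Fin N → ℂ) (hζ : ∀ j, ‖ζ j‖ = 1) (hinj : Function.Injective ζ)
    (q : Fin N → ℝ) (hq : ∀ j, 0 ≤ q j) (ε : ℝ) (hε : 0 < ε) :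
    (∃ C : ℝ, 0 < C ∧ ∀ (f : ℂ → ℂ) (K : ℝ),
      AnalyticOnNhd ℂ f (Metric.ball 0 1) → ‖f 0‖ = 1 →
      (∀ z ∈ Metric.ball (0 : ℂ) 1, ‖f z‖ ≤ Real.exp (K * growthBoundary ζ q z)) →
      ZeroSumLE f (zeroWeight 1 ε ζ q) (C * K)) ∧
    (∀ p : ℝ, 0 ≤ p → ∃ C : ℝ, 0 < C ∧ ∀ (f : ℂ → ℂ) (K : ℝ),
      AnalyticOnNhd ℂ f (Metric.ball 0 1) → ‖f 0‖ = 1 →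
      (∀ z ∈ Metric.ball (0 : ℂ) 1, ‖f z‖ ≤ Real.exp (K * growthRadial p ζ q z)) →
      ZeroSumLE f (zeroWeight (p + 1 + ε) ε ζ q) (C * K)) := by

  refine ⟨?_, fun p hp => ?_⟩
  · obtain ⟨C, hC, h⟩ := zeroBound_growthBoundary hζ hinj hq hε
    exact ⟨C, hC, fun f K hf h0 hg =>
      (h f K hf h0 hg).zeroSumLE fun z hz => zeroWeight_nonneg hz⟩
  · obtain ⟨C, hC, h⟩ := zeroBound_growthRadial hζ hinj hq hε hp
    exact ⟨C, hC, fun f K hf h0 hg =>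
      (h f K hf h0 hg).zeroSumLE fun z hz => zeroWeight_nonneg hz⟩
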